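/- Let $M$ be a smooth manifold of dimension $2n+1$, $n\ge 1$, with a contact sub-Riemannian structure $(\Delta,g)$: $\Delta\subset TM$ is locally the kernel of a smooth $1$-form $\omega$ with $\omega\wedge(d\omega)^n\neq 0$, and $g$ is a smooth scalar product on $\Delta$. Let $H(p,q)=\frac12\sup_{v\in\Delta_q\setminus\{0\}}\langle p,v\rangle^2/g_q(v,v)$ be the sub-Riemannian Hamiltonian on $T^*M$; normal extremals are the integral curves $t\mapsto e^{t\vec H}(\cdot)$ of its Hamiltonian vector field $\vec H$. Let $q_0\in M$ and suppose that the structure is in Agrachev--Gauthier normal form at $q_0$, that is, we are given smooth coordinates $(x,z)=(x_1,\dots,x_{2n},z)$ on a neighborhood $V$ of $q_0=(0,0)$ and a smooth $g$-orthonormal frame $X_1,\dots,X_{2n}$ of $\Delta$ on $V$ such that, writing $(Y)_k$ for the components of a vector field $Y$ in the basis $(\partial_{x_1},\dots,\partial_{x_{2n}},\partial_z)$, on $V$: 1. $(X_i)_j=(X_j)_i$ and $\sum_{j=1}^{2n}(X_j)_i\,x_j=x_i$ for all $1\le i,j\le 2n$; 2. $\sum_{j=1}^{2n}(X_j)_{2n+1}\,x_j=0$;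 3. $X_0:=\partial_z$ satisfies $\omega(X_0)=1$ and $\iota_{X_0}d\omega=0$, where $\omega$ is a smooth $1$-form with $\ker\omega=\Delta$ and $(d\omega)^n|_\Delta=\mathrm{vol}_g$ (for an orientation of $\Delta$); 4. with $c_{ij}^k$ defined by $[X_i,X_j]=\sum_{k=0}^{2n}c_{ij}^kX_k$, the matrix $\bar J=(c_{ji}^0(q_0))_{1\le i,j\le 2n}$ is block diagonal with blocks $\begin{pmatrix}0&b_i\\-b_i&0\end{pmatrix}$, $b_i>0$, $1\le i\le n$. For $q\in V$ and $p\in T_q^*M$ let $h_i=\langle p,X_i(q)\rangle$, $0\le i\le 2n$, and $h=(h_1,\dots,h_{2n})$; $(h,h_0)$ are the coordinates used on $T^*_qM$. For $t\in\mathbb R$ and $h,y\in\mathbb R^{2n}$ set $$\hat h(t,h)=e^{t\bar J}h,\qquad \hat x(t,h)=\bar J^{-1}(e^{t\bar J}-I_{2n})h,\qquad \hat z(t,h)=\sum_{i=1}^n(h_{2i-1}^2+h_{2i}^2)\frac{b_it-\sin(b_it)}{2b_i},$$ $$J^{(1)}_{i,j}(y)=\sum_{k=1}^{2n}\Big(\frac{\partial^2(X_i)_{2n+1}}{\partial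 x_j\partial x_k}(0)-\frac{\partial^2(X_j)_{2n+1}}{\partial x_i\partial x_k}(0)\Big)y_k ,\qquad 1\le i,j\le 2n,$$ and $B_R=\{h\in\mathbb R^{2n}:\sum_{i=1}^{2n}h_i^2\le R\}$. Then for all $T,R>0$ there is $\eta_0>0$ such that for all $\eta\in(0,\eta_0)$ and $h(0)\in B_R$ the normal extremal starting at $q_0$ with initial covector $(h(0),\eta^{-1})$ exists on the time interval $[0,\eta T]$ and stays over $V$, with $h_0>0$. Write, for $\tau\in[0,T]$, $$e^{\eta\tau\vec H}\big((0,0),(h(0),\eta^{-1})\big)=\big((x(\tau),z(\tau)),(h(\tau),\eta^{-1}w(\tau)^{-1})\big)$$ in these coordinates. Then, as $\eta\to0^+$, uniformly with respect to $\tau\in[0,T]$ and $h(0)\in B_R$, $$x(\tau)=\eta\,\hat x(\tau,h(0))+\eta^2\int_0^\tau\!\int_0^\sigma e^{(\sigma-\rho)\bar J}J^{(1)}\big(\hat x(\rho,h(0))\big)\hat h(\rho,h(0))\,d\rho\,d\sigma+O(\eta^3),\qquad z(\tau)=\eta^2\hat z(\tau,h(0))+O(\eta^3),$$ $$h(\tau)=\hat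 h(\tau,h(0))+\eta\int_0^\tau e^{(\tau-\sigma)\bar J}J^{(1)}\big(\hat x(\sigma,h(0))\big)\hat h(\sigma,h(0))\,d\sigma+O(\eta^2),\qquad w(\tau)=1+O(\eta^2).$$ -/

import Mathlib

open Set MeasureTheory
open scoped Manifold ContDiff

noncomputable section

namespace SubRiem

/-- Indices of the `2n` horizontal directions: `(i, 0)` stands for `2i-1`, `(i, 1)` for `2i`. -/
abbrev HIdx (n : ℕ) : Type := Fin n × Fin 2

/-- Horizontal vectors `(y_1, …, y_{2n})`. -/
abbrev Hor (n : ℕ) : Type := HIdx n → ℝ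

/-- The coordinate space `ℝ^{2n+1}`, with points `(x, z)`. -/
abbrev Coord (n : ℕ) : Type := Hor n × ℝ

/-- The coordinate vector `∂_{x_k}`. -/
def dx {n : ℕ} (k : HIdx n) : Coord n := (Pi.single k 1, 0)

/-- The coordinate vector `∂_z`. -/
def dz (n : ℕ) : Coord n := (0, 1)

/-- The partial derivative `∂f/∂x_k` of a function of `(x, z)`. -/
def pdx {n : ℕ} (k : HIdx n) (f : Coord n → ℝ) (y : Coord n) : ℝ := fderiv ℝ f y (dx k)

/-! ### Differential forms in coordinates -/

/-- The exterior derivative `(dα)_y(u, v)` of a `1`-form on `ℝ^{2n+1}`. -/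
def extD {n : ℕ} (α : Coord n → (Coord n →L[ℝ] ℝ)) (y u v : Coord n) : ℝ :=
  fderiv ℝ α y u v - fderiv ℝ α y v u

/-- The value `(dα)^n_y(v_1, …, v_{2n})` of the `n`-th exterior power of `dα`. -/
def extDPow {n : ℕ} (α : Coord n → (Coord n →L[ℝ] ℝ)) (y : Coord n)
    (v : HIdx n → Coord n) : ℝ :=
  (1 / 2 ^ n : ℝ) * ∑ σ : Equiv.Perm (HIdx n),
    ((Equiv.Perm.sign σ : ℤ) : ℝ) * ∏ i : Fin n, extD α y (v (σ (i, 0))) (v (σ (i, 1)))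

/-- The value `(α ∧ (dα)^n)_y(v_0, v_1, …, v_{2n})`; the index `none` stands for `0`. -/
def contactWedge {n : ℕ} (α : Coord n → (Coord n →L[ℝ] ℝ)) (y : Coord n)
    (v : Option (HIdx n) → Coord n) : ℝ :=
  (1 / 2 ^ n : ℝ) * ∑ σ : Equiv.Perm (Option (HIdx n)),
    ((Equiv.Perm.sign σ : ℤ) : ℝ) * (α y (v (σ none)) *
      ∏ i : Fin n, extD α y (v (σ (some (i, 0)))) (v (σ (some (i, 1)))))

/-! ### Manifolds of dimension `2n+1` and their charts -/

section Charts

variable {n : ℕ} {M : Type*} [TopologicalSpace M] [ChartedSpace (Coord n) M]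

/-- The differential of a chart `φ` at `q`, as a map `T_q M → ℝ^{2n+1}`. -/
def chartDeriv (φ : OpenPartialHomeomorph M (Coord n)) (q : M) :
    TangentSpace 𝓘(ℝ, Coord n) q →L[ℝ] Coord n :=
  mfderiv 𝓘(ℝ, Coord n) 𝓘(ℝ, Coord n) φ q

/-- The expression of a vector field in a chart. -/
def fieldInChart (φ : OpenPartialHomeomorph M (Coord n))
    (Y : (q : M) → TangentSpace 𝓘(ℝ, Coord n) q) (y : Coord n) : Coord n :=
  chartDeriv φ (φ.symm y) (Y (φ.symm y))

variable (n M) in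
/-- The cotangent bundle `T^*M`, as the set of pairs of a point `q` and a covector at `q`. -/
abbrev CotBundle : Type _ := (q : M) × (TangentSpace 𝓘(ℝ, Coord n) q →L[ℝ] ℝ)

/-- The coordinates (dual to those of the chart) of a covector. -/
def covInChart (φ : OpenPartialHomeomorph M (Coord n)) (c : CotBundle n M) :
    Coord n →L[ℝ] ℝ :=
  c.2.comp (chartDeriv φ c.1).inverse

end Charts

/-- A contact sub-Riemannian structure `(Δ, g)` on the manifold `M` of dimension `2n+1`. -/
structure ContactSubRiemannian (n : ℕ) (M : Type*) [TopologicalSpace M]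
    [ChartedSpace (Coord n) M] where
  /-- the distribution `Δ ⊆ TM` -/
  Δ : (q : M) → Submodule ℝ (TangentSpace 𝓘(ℝ, Coord n) q)
  /-- locally `Δ` is the kernel of a smooth `1`-form `α` with `α ∧ (dα)^n ≠ 0` -/
  contact : ∀ q₀ : M, ∃ φ ∈ IsManifold.maximalAtlas 𝓘(ℝ, Coord n) ∞ M, q₀ ∈ φ.source ∧
    ∃ α : Coord n → (Coord n →L[ℝ] ℝ), ContDiffOn ℝ ∞ α φ.target ∧
      (∀ q ∈ φ.source, ∀ v, v ∈ Δ q ↔ α (φ q) (chartDeriv φ q v) = 0) ∧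
      ∀ y ∈ φ.target, ∃ v, contactWedge α y v ≠ 0
  /-- the scalar product on `Δ` -/
  g : (q : M) → Δ q →ₗ[ℝ] Δ q →ₗ[ℝ] ℝ
  g_symm : ∀ q u v, g q u v = g q v u
  g_pos : ∀ q u, u ≠ 0 → 0 < g q u u
  /-- `g(Y, Z)` is smooth for all smooth (local) sections `Y`, `Z` of `Δ` -/
  g_smooth : ∀ φ ∈ IsManifold.maximalAtlas 𝓘(ℝ, Coord n) ∞ M, ∀ Y Z : (q : M) → Δ q,
    ContDiffOn ℝ ∞ (fieldInChart φ fun q => (Y q : TangentSpace 𝓘(ℝ, Coord n) q)) φ.target →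
    ContDiffOn ℝ ∞ (fieldInChart φ fun q => (Z q : TangentSpace 𝓘(ℝ, Coord n) q)) φ.target →
    ContDiffOn ℝ ∞ (fun y => g (φ.symm y) (Y (φ.symm y)) (Z (φ.symm y))) φ.target

namespace ContactSubRiemannian

variable {n : ℕ} {M : Type*} [TopologicalSpace M] [ChartedSpace (Coord n) M]

/-- The sub-Riemannian Hamiltonian
`H(p, q) = 1/2 sup { ⟨p, v⟩² / g_q(v, v) : v ∈ Δ_q, v ≠ 0 }`. -/
def ham (S : ContactSubRiemannian n M) (c : CotBundle n M) : ℝ :=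
  (1 / 2 : ℝ) * sSup {r : ℝ | ∃ v : S.Δ c.1, v ≠ 0 ∧ r = (c.2 v) ^ 2 / S.g c.1 v v}

/-- The Hamiltonian in the canonical coordinates `(y, ξ)` of `T^*M` given by a chart. -/
def hamInChart (S : ContactSubRiemannian n M) (φ : OpenPartialHomeomorph M (Coord n))
    (y : Coord n) (ξ : Coord n →L[ℝ] ℝ) : ℝ :=
  S.ham ⟨φ.symm y, ξ.comp (chartDeriv φ (φ.symm y))⟩

/-- Normal extremals on the time set `s`: integral curves in `T^*M` of the Hamiltonian vector
field of `H`, that is, curves over a continuous curve of `M` which satisfy Hamilton's equations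
`y' = ∂H/∂ξ`, `ξ' = -∂H/∂y` in all canonical coordinates `(y, ξ)` of `T^*M`. -/
def IsNormalExtremal (S : ContactSubRiemannian n M) (c : ℝ → CotBundle n M) (s : Set ℝ) :
    Prop :=
  ContinuousOn (fun t => (c t).1) s ∧
  ∀ t ∈ s, ∀ φ ∈ IsManifold.maximalAtlas 𝓘(ℝ, Coord n) ∞ M, (c t).1 ∈ φ.source →
    (∃ v : Coord n, HasDerivWithinAt (fun u => φ (c u).1) v s t ∧
      ∀ ζ : Coord n →L[ℝ] ℝ,
        ζ v = fderiv ℝ (fun ξ => S.hamInChart φ (φ (c t).1) ξ) (covInChart φ (c t)) ζ) ∧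
    HasDerivWithinAt (fun u => covInChart φ (c u))
      (-(fderiv ℝ (fun y => S.hamInChart φ y (covInChart φ (c t))) (φ (c t).1))) s t

end ContactSubRiemannian

/-! ### The nilpotent model -/

/-- The block diagonal matrix with blocks `(0, b_i; -b_i, 0)`. -/
def Jbar {n : ℕ} (b : Fin n → ℝ) : Matrix (HIdx n) (HIdx n) ℝ := fun k l =>
  if k.1 = l.1 then
    (if k.2 = 0 ∧ l.2 = 1 then b k.1 else if k.2 = 1 ∧ l.2 = 0 then -b k.1 else 0)
  else 0

/-- `e^{t J̄}` -/
def expJ {n : ℕ} (b : Fin n → ℝ) (t : ℝ) : Matrix (HIdx n) (HIdx n) ℝ :=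
  NormedSpace.exp (t • Jbar b)

/-- `ĥ(t, h) = e^{t J̄} h` -/
def hHat {n : ℕ} (b : Fin n → ℝ) (t : ℝ) (h : Hor n) : Hor n :=
  (expJ b t).mulVec h

/-- `x̂(t, h) = J̄⁻¹ (e^{t J̄} - I) h` -/
def xHat {n : ℕ} (b : Fin n → ℝ) (t : ℝ) (h : Hor n) : Hor n :=
  ((Jbar b)⁻¹ * (expJ b t - 1)).mulVec h

/-- `ẑ(t, h) = ∑ᵢ (h_{2i-1}² + h_{2i}²) (bᵢ t - sin (bᵢ t)) / (2 bᵢ)` -/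
def zHat {n : ℕ} (b : Fin n → ℝ) (t : ℝ) (h : Hor n) : ℝ :=
  ∑ i : Fin n, (h (i, 0) ^ 2 + h (i, 1) ^ 2) * ((b i * t - Real.sin (b i * t)) / (2 * b i))

/-- `B_R = {h : ∑ h_i² ≤ R}` -/
def ballB (n : ℕ) (R : ℝ) : Set (Hor n) := {h | ∑ k, h k ^ 2 ≤ R}

/-! ### The normal form -/

/-- Agrachev–Gauthier normal form at `q₀` of a contact sub-Riemannian structure: a chart
`φ = (x, z)` centered at `q₀`, and a frame `X_1, …, X_{2n}` of `(Δ, g)` on its domain, with the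
symmetries of that normal form, with `X_0 = ∂_z` the Reeb field, and with the matrix
`J̄ = J(q₀)` in reduced form. -/
structure AGNormalForm {n : ℕ} {M : Type*} [TopologicalSpace M] [ChartedSpace (Coord n) M]
    (S : ContactSubRiemannian n M) (q₀ : M) where
  /-- the coordinates -/
  φ : OpenPartialHomeomorph M (Coord n)
  φ_mem : φ ∈ IsManifold.maximalAtlas 𝓘(ℝ, Coord n) ∞ M
  mem_source : q₀ ∈ φ.source
  φ_center : φ q₀ = 0
  /-- the frame -/
  X : HIdx n → (q : M) → S.Δ q
  X_smooth : ∀ k, ContDiffOn ℝ ∞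
    (fieldInChart φ fun q => (X k q : TangentSpace 𝓘(ℝ, Coord n) q)) φ.target
  X_orthonormal : ∀ q ∈ φ.source, ∀ k l, S.g q (X k q) (X l q) = if k = l then 1 else 0
  /-- `(X_k)_l = (X_l)_k` -/
  hor_symm : ∀ y ∈ φ.target, ∀ k l,
    (fieldInChart φ (fun q => (X k q : TangentSpace 𝓘(ℝ, Coord n) q)) y).1 l =
      (fieldInChart φ (fun q => (X l q : TangentSpace 𝓘(ℝ, Coord n) q)) y).1 k
  /-- `∑ₗ (X_l)_k x_l = x_k` -/
  hor_radial : ∀ y ∈ φ.target, ∀ k,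
    ∑ l, (fieldInChart φ (fun q => (X l q : TangentSpace 𝓘(ℝ, Coord n) q)) y).1 k * y.1 l = y.1 k
  /-- `∑ₗ (X_l)_{2n+1} x_l = 0` -/
  vert_radial : ∀ y ∈ φ.target,
    ∑ l, (fieldInChart φ (fun q => (X l q : TangentSpace 𝓘(ℝ, Coord n) q)) y).2 * y.1 l = 0
  /-- the contact form, in coordinates -/
  θ : Coord n → (Coord n →L[ℝ] ℝ)
  θ_smooth : ContDiffOn ℝ ∞ θ φ.target
  θ_ker : ∀ q ∈ φ.source, ∀ v, v ∈ S.Δ q ↔ θ (φ q) (chartDeriv φ q v) = 0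
  /-- `(dθ)^n` restricted to `Δ` is the volume form of `g`, for an orientation of `Δ` -/
  θ_vol : ∀ y ∈ φ.target, |extDPow θ y fun k =>
    fieldInChart φ (fun q => (X k q : TangentSpace 𝓘(ℝ, Coord n) q)) y| = 1
  /-- `θ(X_0) = 1` with `X_0 = ∂_z` -/
  θ_reeb : ∀ y ∈ φ.target, θ y (dz n) = 1
  /-- `dθ(X_0, ·) = 0` -/
  dθ_reeb : ∀ y ∈ φ.target, ∀ v, extD θ y (dz n) v = 0
  /-- the nilpotent invariants at `q₀` -/
  b : Fin n → ℝ
  b_pos : ∀ i, 0 < b i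
  /-- the coefficient `c_{lk}^0(q₀)` of `[X_l, X_k](q₀)` along `X_0`, that is `J_{kl}(q₀)`, is
  the entry `(k, l)` of the block diagonal matrix `J̄` -/
  reduced : ∀ k l, ∃ c : HIdx n → ℝ,
    VectorField.lieBracket ℝ
        (fieldInChart φ fun q => (X l q : TangentSpace 𝓘(ℝ, Coord n) q))
        (fieldInChart φ fun q => (X k q : TangentSpace 𝓘(ℝ, Coord n) q)) 0 =
      (∑ m, c m • fieldInChart φ (fun q => (X m q : TangentSpace 𝓘(ℝ, Coord n) q)) 0) +
        Jbar b k l • dz n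

namespace AGNormalForm

variable {n : ℕ} {M : Type*} [TopologicalSpace M] [ChartedSpace (Coord n) M]
  {S : ContactSubRiemannian n M} {q₀ : M}

/-- The frame vector field `X_k`, in normal form coordinates. -/
def Xc (N : AGNormalForm S q₀) (k : HIdx n) : Coord n → Coord n :=
  fieldInChart N.φ fun q => (N.X k q : TangentSpace 𝓘(ℝ, Coord n) q)

/-- The matrix `J^{(1)}(y)`. -/
def J1 (N : AGNormalForm S q₀) (y : Hor n) : Matrix (HIdx n) (HIdx n) ℝ := fun i j =>
  ∑ k, (pdx j (pdx k fun u => (N.Xc i u).2) 0 - pdx i (pdx k fun u => (N.Xc j u).2) 0) * y k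

/-- The coordinates `x`. -/
def xCoord (N : AGNormalForm S q₀) (c : CotBundle n M) : Hor n := (N.φ c.1).1

/-- The coordinate `z`. -/
def zCoord (N : AGNormalForm S q₀) (c : CotBundle n M) : ℝ := (N.φ c.1).2

/-- The coordinates `h_k = ⟨p, X_k(q)⟩`, `1 ≤ k ≤ 2n`. -/
def hCoord (N : AGNormalForm S q₀) (c : CotBundle n M) : Hor n := fun k => c.2 (N.X k c.1)

/-- The coordinate `h_0 = ⟨p, X_0(q)⟩`, where `X_0 = ∂_z`. -/
def h0Coord (N : AGNormalForm S q₀) (c : CotBundle n M) : ℝ :=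
  c.2 ((chartDeriv N.φ c.1).inverse (dz n))

/-- `c` is the point of `T^*_{q₀} M` with coordinates `(h, h_0) = (h, η⁻¹)`. -/
def IsInitial (N : AGNormalForm S q₀) (h : Hor n) (η : ℝ) (c : CotBundle n M) : Prop :=
  c.1 = q₀ ∧ N.hCoord c = h ∧ N.h0Coord c = η⁻¹

/-- The first order term of `h`:
`∫₀^τ e^{(τ-σ)J̄} J^{(1)}(x̂(σ, h)) ĥ(σ, h) dσ`. -/
def h1 (N : AGNormalForm S q₀) (τ : ℝ) (h : Hor n) : Hor n :=
  ∫ σ in (0 : ℝ)..τ,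
    (expJ N.b (τ - σ)).mulVec ((N.J1 (xHat N.b σ h)).mulVec (hHat N.b σ h))

/-- The second order term of `x`:
`∫₀^τ ∫₀^σ e^{(σ-ρ)J̄} J^{(1)}(x̂(ρ, h)) ĥ(ρ, h) dρ dσ`. -/
def x2 (N : AGNormalForm S q₀) (τ : ℝ) (h : Hor n) : Hor n :=
  ∫ σ in (0 : ℝ)..τ, ∫ ρ in (0 : ℝ)..σ,
    (expJ N.b (σ - ρ)).mulVec ((N.J1 (xHat N.b ρ h)).mulVec (hHat N.b ρ h))

end AGNormalForm

end SubRiem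

end

/-! The Hamiltonian is quadratic in the covector. Dividing time by `η` and multiplying covectors by
`η` therefore turns the extremal from `(h, η⁻¹)` on `[0, ηT]` into a solution on the fixed interval
`[0, T]` that starts over the origin at `dz + η ∑ h_k dx_k` (`hasDerivWithinAt_rescale`). As `η → 0`
this start tends to `restPoint`, an equilibrium because `dz` annihilates every `X_k(0) = ∂_{x_k}`.
The solutions thus live on all of `[0, T]` within `O(η)` of the equilibrium
(`exists_solutionFamily`), and the theorem is a perturbation expansion there.

The symmetries of the normal form fix the first jet of the frame, `X_k = ∂_{x_k} + ½ (J̄x)_k ∂_z +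
O(2)` (`isBigO_frame`). The momenta `P_k = ⟨ξ, X_k⟩` satisfy `P_k' = ∑ P_l ⟨ξ, [X_l, X_k]⟩`, and
along the solutions `⟨ξ, ∂_z⟩ = 1 + O(η²)` and `z = O(η²)`. Expanding the bracket gives `P' = (J̄ +
J¹(x)) P + O(η³)`, `x' = P + O(η³)`, `z' = ½ ∑ P_k (J̄x)_k + O(η³)`, where `J¹` is `frameJ1`.
Grönwall's lemma (`isBigO_unif_of_deriv`) compares solutions with candidate expansions uniformly in
`τ` and `h`: a first pass gives the leading terms of `P` and `x`, and inserting them gives the next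
order. Undoing the scaling divides `P` by `η`, so `h` is known to one order less than `x`, and `w`
is the inverse of `⟨ξ, ∂_z⟩`.

To return to `M`, Cauchy–Schwarz gives `H = ½ ∑ ⟨p, X_k⟩²` over the chart (`ham_eq`). Hamilton's
equations are invariant under cotangent lifts (`hasDerivWithinAt_cov_of_change`), so the solution in
the normal form chart is a normal extremal. Any other extremal with the same initial covector agrees
with it (`chartCov_eq_of_isNormalExtremal`). -/

namespace SubRiem

open Filter Topology Asymptotics
open scoped NNReal Matrix

/-! ### Ordinary differential equations -/

section ODE

variable {E : Type*} [NormedAddCommGroup E] [NormedSpace ℝ E]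

/-- At speed at most `L` a solution cannot leave the ball of radius `L * T` before time `T`, so
Picard–Lindelöf applied on that ball covers the whole interval at once. -/
theorem exists_solution_of_lipschitz_of_bounded [CompleteSpace E] {F : E → E} {K L : ℝ≥0}
    (hF : LipschitzWith K F) (hL : ∀ x, ‖F x‖ ≤ L) (v : E) {T : ℝ} (hT : 0 ≤ T) :
    ∃ u : ℝ → E, u 0 = v ∧ ∀ t ∈ Icc 0 T, HasDerivWithinAt u (F (u t)) (Icc 0 T) t := by
  have hpl : IsPicardLindelof (fun _ => F) (⟨0, left_mem_Icc.2 hT⟩ : Icc 0 T) v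
      (L * ⟨T, hT⟩) 0 L K := by
    refine IsPicardLindelof.of_time_independent (fun x _ => hL x) (hF.lipschitzOnWith) ?_
    simp only [sub_zero, sub_self, NNReal.coe_zero, max_eq_left hT]
    exact le_rfl
  exact hpl.exists_eq_forall_mem_Icc_hasDerivWithinAt₀

/-- A `C^1` germ of a vector field extends to a bounded Lipschitz vector field. -/
theorem exists_lipschitz_bounded_germ [FiniteDimensional ℝ E] {F : E → E} {e : E}
    (hF : ContDiffAt ℝ 1 F e) :
    ∃ (G : E → E) (K L : ℝ≥0), LipschitzWith K G ∧ (∀ x, ‖G x‖ ≤ L) ∧ G =ᶠ[𝓝 e] F := by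
  obtain ⟨u, hu, hFu⟩ := hF.contDiffOn (m := 1) le_rfl (by simp)
  obtain ⟨r, hr, hru⟩ := Metric.mem_nhds_iff.1 hu
  let χ : ContDiffBump e := ⟨r / 4, r / 2, by positivity, by linarith⟩
  have hsupp : tsupport χ ⊆ Metric.ball e r := by
    rw [χ.tsupport_eq]
    exact Metric.closedBall_subset_ball (by simp only [χ]; linarith)
  have hG : ContDiff ℝ 1 (fun x => χ x • F x) := by
    rw [contDiff_iff_contDiffAt]
    intro x
    by_cases hx : x ∈ tsupport χ
    · refine χ.contDiff.contDiffAt.smul (hFu.contDiffAt ?_)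
      exact mem_of_superset (Metric.isOpen_ball.mem_nhds (hsupp hx)) hru
    · have : (fun x => χ x • F x) =ᶠ[𝓝 x] fun _ => 0 := by
        filter_upwards [(isClosed_tsupport χ).isOpen_compl.mem_nhds hx] with y hy
        rw [image_eq_zero_of_notMem_tsupport hy, zero_smul]
      exact contDiffAt_const.congr_of_eventuallyEq this
  have hc : HasCompactSupport (fun x => χ x • F x) := χ.hasCompactSupport.smul_right
  obtain ⟨K, hK⟩ := hG.lipschitzWith_of_hasCompactSupport hc one_ne_zero
  obtain ⟨C, hC⟩ := hc.exists_bound_of_continuous hG.continuous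
  refine ⟨_, K, ⟨C, (norm_nonneg _).trans (hC e)⟩, hK, hC, ?_⟩
  filter_upwards [χ.eventuallyEq_one] with x hx
  simp [hx]

/-- Grönwall against the constant solution `e`. The bound is linear in the initial distance, so
starting points at distance `O(η)` yield trajectories at distance `O(η)`. -/
theorem norm_sub_le_of_solution {F : E → E} {K : ℝ≥0} (hF : LipschitzWith K F) {e : E}
    (he : F e = 0) {T : ℝ} {u : ℝ → E}
    (hu : ∀ t ∈ Icc 0 T, HasDerivWithinAt u (F (u t)) (Icc 0 T) t) {t : ℝ} (ht : t ∈ Icc 0 T) :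
    ‖u t - e‖ ≤ ‖u 0 - e‖ * Real.exp (K * T) := by
  have h := dist_le_of_trajectories_ODE (v := fun _ => F) (f := u) (g := fun _ => e) (a := 0)
    (b := T) (δ := ‖u 0 - e‖) (fun _ => hF) (fun s hs => (hu s hs).continuousWithinAt)
    (fun s hs => ((hu s (Ico_subset_Icc_self hs)).mono_of_mem_nhdsWithin
      (Icc_mem_nhdsGE_of_mem hs)))
    continuousOn_const (fun s _ => by simpa [he] using hasDerivWithinAt_const s _ e)
    (by rw [dist_eq_norm]) t ht
  rw [dist_eq_norm] at h
  refine h.trans ?_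
  have : t - 0 ≤ T := by simpa using ht.2
  gcongr

end ODE

/-! ### Asymptotic expansions uniform in the parameters -/

section Uniform

variable {β : Type*} {E F : Type*} [NormedAddCommGroup E] [NormedSpace ℝ E]
  [NormedAddCommGroup F]

/-- The filter `η → 0⁺`, uniformly with respect to `h ∈ B` and `τ ∈ [0, T]`, on the triples
`(η, h, τ)`. -/
def unif (B : Set β) (T : ℝ) : Filter (ℝ × β × ℝ) := 𝓝[>] 0 ×ˢ 𝓟 (B ×ˢ Icc 0 T)

variable {B : Set β} {T : ℝ}

theorem eventually_unif {P : ℝ × β × ℝ → Prop} :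
    (∀ᶠ p in unif B T, P p) ↔ ∀ᶠ η in 𝓝[>] (0 : ℝ), ∀ h ∈ B, ∀ τ ∈ Icc 0 T, P (η, h, τ) := by
  rw [unif, eventually_prod_principal_iff]
  simp only [Prod.forall, mem_prod, and_imp]
  refine eventually_congr (Eventually.of_forall fun η => ?_)
  exact ⟨fun h a ha b hb => h a b ha hb, fun h a b ha hb => h a ha b hb⟩

theorem isBigO_unif {f : ℝ × β × ℝ → F} {k : ℕ} :
    f =O[unif B T] (fun p => p.1 ^ k) ↔
      ∃ C, ∀ᶠ η in 𝓝[>] (0 : ℝ), ∀ h ∈ B, ∀ τ ∈ Icc 0 T, ‖f (η, h, τ)‖ ≤ C * η ^ k := by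
  rw [isBigO_iff]
  refine exists_congr fun C => ?_
  rw [eventually_unif]
  refine eventually_congr ?_
  filter_upwards [self_mem_nhdsWithin] with η hη
  have : ‖η ^ k‖ = η ^ k := by
    rw [Real.norm_of_nonneg (pow_nonneg (le_of_lt hη) k)]
  simp only [this]

theorem tendsto_unif_fst : Tendsto (fun p : ℝ × β × ℝ => p.1) (unif B T) (𝓝 0) :=
  (tendsto_fst (g := 𝓟 (B ×ˢ Icc 0 T))).mono_right nhdsWithin_le_nhds

theorem isBigO_unif_pow_le {m k : ℕ} (h : m ≤ k) :
    (fun p : ℝ × β × ℝ => p.1 ^ k) =O[unif B T] (fun p => p.1 ^ m) := by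
  obtain ⟨j, rfl⟩ := Nat.exists_eq_add_of_le h
  simp only [pow_add]
  have h1 : (fun p : ℝ × β × ℝ => p.1 ^ j) =O[unif B T] (fun _ => (1 : ℝ)) :=
    (tendsto_unif_fst.pow j).isBigO_one ℝ
  simpa using (isBigO_refl (fun p : ℝ × β × ℝ => p.1 ^ m) (unif B T)).mul h1

/-- Grönwall's lemma, uniformly in the parameters. -/
theorem isBigO_unif_of_deriv {f f' : ℝ × β × ℝ → E} {k : ℕ} (A : E →L[ℝ] E)
    (h0 : ∀ᶠ η in 𝓝[>] (0 : ℝ), ∀ h ∈ B, f (η, h, 0) = 0)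
    (hf : ∀ᶠ η in 𝓝[>] (0 : ℝ), ∀ h ∈ B, ∀ τ ∈ Icc 0 T,
      HasDerivWithinAt (fun s => f (η, h, s)) (f' (η, h, τ)) (Icc 0 T) τ)
    (hA : (fun p => f' p - A (f p)) =O[unif B T] (fun p => p.1 ^ k)) :
    f =O[unif B T] (fun p => p.1 ^ k) := by
  rw [isBigO_unif] at hA ⊢
  obtain ⟨C, hC⟩ := hA
  -- The added `1` keeps the rate nonzero even for `A = 0`, so that the closed formula for
  -- `gronwallBound` applies.
  set K : ℝ := ‖A‖ + 1 with hK
  have hKpos : 0 < K := by positivity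
  refine ⟨|C| / K * (Real.exp (K * T)), ?_⟩
  filter_upwards [h0, hf, hC, self_mem_nhdsWithin] with η h0 hf hC hη h hh τ hτ
  have hη : 0 < η := hη
  have hg := norm_le_gronwallBound_of_norm_deriv_right_le (f := fun s => f (η, h, s))
    (f' := fun s => f' (η, h, s)) (δ := 0) (K := K) (ε := |C| * η ^ k) (a := 0) (b := T)
    (fun s hs => (hf h hh s hs).continuousWithinAt)
    (fun s hs => ((hf h hh s (Ico_subset_Icc_self hs)).mono_of_mem_nhdsWithin
      (Icc_mem_nhdsGE_of_mem hs))) (by simp [h0 h hh]) ?_ τ hτ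
  · refine hg.trans ?_
    rw [gronwallBound_of_K_ne_0 hKpos.ne']
    have hle : Real.exp (K * (τ - 0)) ≤ Real.exp (K * T) := by
      have : τ - 0 ≤ T := by simpa using hτ.2
      gcongr
    have : |C| * η ^ k / K * (Real.exp (K * (τ - 0)) - 1) ≤
        |C| * η ^ k / K * Real.exp (K * T) := by
      gcongr
      linarith
    calc _ ≤ |C| * η ^ k / K * Real.exp (K * T) := by simpa using this
      _ = _ := by ring
  · intro s hs
    have h1 := hC h hh s (Ico_subset_Icc_self hs)
    have h2 : ‖f' (η, h, s)‖ ≤ ‖A (f (η, h, s))‖ + ‖f' (η, h, s) - A (f (η, h, s))‖ := by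
      simpa using norm_add_le (A (f (η, h, s))) (f' (η, h, s) - A (f (η, h, s)))
    have h3 := A.le_opNorm (f (η, h, s))
    have h4 : C * η ^ k ≤ |C| * η ^ k := by
      gcongr
      exact le_abs_self C
    have h5 : ‖A‖ * ‖f (η, h, s)‖ ≤ K * ‖f (η, h, s)‖ := by
      gcongr
      linarith
    linarith

theorem isBigO_unif_of_deriv_zero {f f' : ℝ × β × ℝ → E} {k : ℕ}
    (h0 : ∀ᶠ η in 𝓝[>] (0 : ℝ), ∀ h ∈ B, f (η, h, 0) = 0)
    (hf : ∀ᶠ η in 𝓝[>] (0 : ℝ), ∀ h ∈ B, ∀ τ ∈ Icc 0 T,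
      HasDerivWithinAt (fun s => f (η, h, s)) (f' (η, h, τ)) (Icc 0 T) τ)
    (hA : f' =O[unif B T] (fun p => p.1 ^ k)) :
    f =O[unif B T] (fun p => p.1 ^ k) :=
  isBigO_unif_of_deriv 0 h0 hf (by simpa using hA)

end Uniform

/-! ### Taylor expansions -/

section Taylor

variable {E F : Type*} [NormedAddCommGroup E] [NormedSpace ℝ E]
  [NormedAddCommGroup F] [NormedSpace ℝ F]

theorem isBigO_sub_of_contDiffAt_one {f : E → F} (hf : ContDiffAt ℝ 1 f 0) :
    (fun y => f y - f 0) =O[𝓝 0] (fun y => ‖y‖ ^ 1) := by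
  simpa using ((hf.differentiableAt one_ne_zero).hasFDerivAt.isBigO_sub).norm_right

/-- Mean value inequality on the segment from `0` to `y` for `f` minus its linear part, whose
derivative is at most `C * ‖y‖` there. -/
theorem isBigO_taylor_of_contDiffAt_two {f : E → F} (hf : ContDiffAt ℝ 2 f 0) :
    (fun y => f y - f 0 - fderiv ℝ f 0 y) =O[𝓝 0] (fun y => ‖y‖ ^ 2) := by
  have hd : ContDiffAt ℝ 1 (fderiv ℝ f) 0 := hf.fderiv_right (by norm_num)
  obtain ⟨C, hC0, hC⟩ := (isBigO_sub_of_contDiffAt_one hd).exists_pos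
  have hdiff : ∀ᶠ y in 𝓝 (0 : E), DifferentiableAt ℝ f y := by
    filter_upwards [hf.eventually (by simp)] with y hy
    exact hy.differentiableAt two_ne_zero
  obtain ⟨r, hr, hball⟩ := Metric.eventually_nhds_iff_ball.1 (hdiff.and hC.bound)
  refine IsBigO.of_bound C ?_
  filter_upwards [Metric.ball_mem_nhds (0 : E) hr] with y hy
  have hseg : segment ℝ 0 y ⊆ Metric.ball (0 : E) r :=
    (convex_ball _ _).segment_subset (Metric.mem_ball_self hr) hy
  have hsegn : ∀ x ∈ segment ℝ 0 y, ‖x‖ ≤ ‖y‖ := by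
    rintro x ⟨a, b, ha, hb, hab, rfl⟩
    have : b ≤ 1 := by linarith
    simpa [norm_smul, abs_of_nonneg hb] using mul_le_of_le_one_left (norm_nonneg y) this
  have key := (convex_segment (𝕜 := ℝ) (0 : E) y).norm_image_sub_le_of_norm_hasFDerivWithin_le
    (f := fun x => f x - fderiv ℝ f 0 x) (f' := fun x => fderiv ℝ f x - fderiv ℝ f 0)
    (C := C * ‖y‖)
    (fun x hx => ((hball x (hseg hx)).1.hasFDerivAt.sub
      (fderiv ℝ f 0).hasFDerivAt).hasFDerivWithinAt)
    (fun x hx => by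
      refine (hball x (hseg hx)).2.trans ?_
      simp only [pow_one, norm_norm]
      gcongr
      exact hsegn x hx) (left_mem_segment ℝ 0 y) (right_mem_segment ℝ 0 y)
  simp only [map_zero, sub_zero] at key
  rw [norm_pow, norm_norm]
  calc _ = ‖f y - fderiv ℝ f 0 y - f 0‖ := by congr 1; abel
    _ ≤ _ := key
    _ = _ := by ring

end Taylor

/-! ### The nilpotent model -/

section Model

variable {n : ℕ} (b : Fin n → ℝ)

section

attribute [local instance] Matrix.linftyOpNormedRing Matrix.linftyOpNormedAlgebra

theorem hasDerivAt_expJ_apply (t : ℝ) (i j : HIdx n) :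
    HasDerivAt (fun s => expJ b s i j) ((Jbar b * expJ b t) i j) t := by
  have h : HasDerivAt (fun s : ℝ => NormedSpace.exp (s • Jbar b))
      (Jbar b * NormedSpace.exp (t • Jbar b)) t := hasDerivAt_exp_smul_const' (Jbar b) t
  let L : Matrix (HIdx n) (HIdx n) ℝ →L[ℝ] ℝ := LinearMap.toContinuousLinearMap
    (Matrix.entryLinearMap ℝ ℝ i j)
  exact (L.hasFDerivAt.comp_hasDerivAt t h)

theorem expJ_add (s t : ℝ) : expJ b (s + t) = expJ b s * expJ b t := by
  rw [expJ, add_smul]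
  exact NormedSpace.exp_add_of_commute ((Commute.refl (Jbar b)).smul_left s |>.smul_right t)

end

theorem expJ_zero : expJ b 0 = 1 := by simp [expJ]

theorem hasDerivAt_expJ_mulVec {v : ℝ → Hor n} {v' : Hor n} {t : ℝ} (hv : HasDerivAt v v' t) :
    HasDerivAt (fun s => expJ b s *ᵥ v s) (Jbar b *ᵥ (expJ b t *ᵥ v t) + expJ b t *ᵥ v') t := by
  rw [hasDerivAt_pi]
  intro i
  have h := HasDerivAt.fun_sum (u := Finset.univ) fun j _ =>
    (hasDerivAt_expJ_apply b t i j).mul (hasDerivAt_pi.1 hv j)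
  refine h.congr_deriv ?_
  simp only [Matrix.mulVec_mulVec, Pi.add_apply, Finset.sum_add_distrib]
  rfl

theorem hasDerivAt_hHat (t : ℝ) (h : Hor n) :
    HasDerivAt (fun s => hHat b s h) (Jbar b *ᵥ hHat b t h) t := by
  have h1 := hasDerivAt_expJ_mulVec b (hasDerivAt_const t h)
  rwa [Matrix.mulVec_zero, add_zero] at h1

theorem hHat_zero (h : Hor n) : hHat b 0 h = h := by simp [hHat, expJ_zero]

theorem continuous_hHat (h : Hor n) : Continuous fun t => hHat b t h :=
  continuous_iff_continuousAt.2 fun t => (hasDerivAt_hHat b t h).continuousAt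

theorem Jbar_mulVec_fst (v : Hor n) (i : Fin n) : (Jbar b *ᵥ v) (i, 0) = b i * v (i, 1) := by
  simp [Matrix.mulVec, dotProduct, Fintype.sum_prod_type, Jbar]

theorem Jbar_mulVec_snd (v : Hor n) (i : Fin n) : (Jbar b *ᵥ v) (i, 1) = -b i * v (i, 0) := by
  simp [Matrix.mulVec, dotProduct, Fintype.sum_prod_type, Jbar]

theorem Jbar_antisymm (k l : HIdx n) : Jbar b k l = -Jbar b l k := by
  obtain ⟨i, a⟩ := k
  obtain ⟨j, c⟩ := l
  by_cases h : i = j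
  · subst h
    fin_cases a <;> fin_cases c <;> simp [Jbar]
  · simp [Jbar, h, Ne.symm h]

variable {b}

theorem Jbar_inv_mul_cancel (hb : ∀ i, b i ≠ 0) : (Jbar b)⁻¹ * Jbar b = 1 := by
  refine Matrix.nonsing_inv_mul _ (Matrix.isUnit_det_of_right_inverse
    (B := Jbar fun i => -(b i)⁻¹) ?_)
  refine Matrix.toLin'.injective (LinearMap.ext fun v => ?_)
  rw [Matrix.toLin'_mul, Matrix.toLin'_one]
  ext ⟨i, a⟩
  simp only [LinearMap.comp_apply, Matrix.toLin'_apply, LinearMap.id_apply]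
  fin_cases a
  · simp only [Fin.zero_eta, Jbar_mulVec_fst, Jbar_mulVec_snd]
    field_simp [hb i]
  · simp only [Fin.mk_one, Jbar_mulVec_fst, Jbar_mulVec_snd]
    field_simp [hb i]

theorem Jbar_mul_inv_cancel (hb : ∀ i, b i ≠ 0) : Jbar b * (Jbar b)⁻¹ = 1 :=
  mul_eq_one_comm.1 (Jbar_inv_mul_cancel hb)

theorem Jbar_mulVec_xHat (hb : ∀ i, b i ≠ 0) (t : ℝ) (h : Hor n) :
    Jbar b *ᵥ xHat b t h = hHat b t h - h := by
  rw [xHat, Matrix.mulVec_mulVec, ← mul_assoc, Jbar_mul_inv_cancel hb, one_mul,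
    Matrix.sub_mulVec, Matrix.one_mulVec, hHat]

theorem hasDerivAt_mulVec (A : Matrix (HIdx n) (HIdx n) ℝ) {v : ℝ → Hor n} {v' : Hor n} {t : ℝ}
    (hv : HasDerivAt v v' t) : HasDerivAt (fun s => A *ᵥ v s) (A *ᵥ v') t :=
  (LinearMap.toContinuousLinearMap A.mulVecLin).hasFDerivAt.comp_hasDerivAt t hv

theorem hasDerivAt_xHat (hb : ∀ i, b i ≠ 0) (t : ℝ) (h : Hor n) :
    HasDerivAt (fun s => xHat b s h) (hHat b t h) t := by
  have h1 := hasDerivAt_mulVec (Jbar b)⁻¹ ((hasDerivAt_hHat b t h).sub_const h)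
  rw [Matrix.mulVec_mulVec, Jbar_inv_mul_cancel hb, Matrix.one_mulVec] at h1
  refine h1.congr_of_eventuallyEq (Eventually.of_forall fun s => ?_)
  simp [xHat, hHat, ← Matrix.mulVec_mulVec, Matrix.sub_mulVec]

theorem xHat_zero (h : Hor n) : xHat b 0 h = 0 := by simp [xHat, expJ_zero]

theorem continuous_xHat (hb : ∀ i, b i ≠ 0) (h : Hor n) : Continuous fun t => xHat b t h :=
  continuous_iff_continuousAt.2 fun t => (hasDerivAt_xHat hb t h).continuousAt

-- Rotating the `i`-th block of `ĥ` back by the angle `b i * t` gives two functions with zero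
-- derivative, hence equal to their values at `t = 0`.
variable (b) in
theorem hHat_eq (t : ℝ) (h : Hor n) (i : Fin n) :
    hHat b t h (i, 0) = Real.cos (b i * t) * h (i, 0) + Real.sin (b i * t) * h (i, 1) ∧
      hHat b t h (i, 1) = -Real.sin (b i * t) * h (i, 0) + Real.cos (b i * t) * h (i, 1) := by
  have hd := fun s => hasDerivAt_pi.1 (hasDerivAt_hHat b s h)
  have hlin : ∀ s, HasDerivAt (fun s : ℝ => b i * s) (b i) s := fun s => by
    simpa using (hasDerivAt_id s).const_mul (b i)
  have h0 := fun s => hd s (i, 0)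
  have h1 := fun s => hd s (i, 1)
  simp only [Jbar_mulVec_fst, Jbar_mulVec_snd] at h0 h1
  have hc := fun s => (hlin s).cos
  have hs := fun s => (hlin s).sin
  have e0 : ∀ s, HasDerivAt (fun s => Real.cos (b i * s) * hHat b s h (i, 0) -
      Real.sin (b i * s) * hHat b s h (i, 1)) 0 s := fun s =>
    (((hc s).mul (h0 s)).sub ((hs s).mul (h1 s))).congr_deriv (by ring)
  have e1 : ∀ s, HasDerivAt (fun s => Real.sin (b i * s) * hHat b s h (i, 0) +
      Real.cos (b i * s) * hHat b s h (i, 1)) 0 s := fun s =>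
    (((hs s).mul (h0 s)).add ((hc s).mul (h1 s))).congr_deriv (by ring)
  have c0 := is_const_of_deriv_eq_zero (fun s => (e0 s).differentiableAt)
    (fun s => (e0 s).deriv) t 0
  have c1 := is_const_of_deriv_eq_zero (fun s => (e1 s).differentiableAt)
    (fun s => (e1 s).deriv) t 0
  simp only [hHat_zero, mul_zero, Real.cos_zero, Real.sin_zero, one_mul, zero_mul, sub_zero,
    zero_add] at c0 c1
  have hsc := Real.sin_sq_add_cos_sq (b i * t)
  rw [← c0, ← c1]
  constructor
  · linear_combination -hHat b t h (i, 0) * hsc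
  · linear_combination -hHat b t h (i, 1) * hsc

/-- This is the limit equation for `z`. As `J̄ x̂ = ĥ - h` and rotations preserve the norm of each
block, `½ ⟨ĥ, J̄ x̂⟩` reduces to a sum of terms `(1 - cos (b i * t)) / 2` times squared block norms
of `h`. -/
theorem hasDerivAt_zHat (hb : ∀ i, b i ≠ 0) (t : ℝ) (h : Hor n) :
    HasDerivAt (fun s => zHat b s h)
      (∑ k, hHat b t h k * ((1 / 2) * (Jbar b *ᵥ xHat b t h) k)) t := by
  have hd : ∀ i : Fin n, HasDerivAt
      (fun s => (h (i, 0) ^ 2 + h (i, 1) ^ 2) * ((b i * s - Real.sin (b i * s)) / (2 * b i)))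
      ((h (i, 0) ^ 2 + h (i, 1) ^ 2) * ((b i - Real.cos (b i * t) * b i) / (2 * b i))) t := by
    intro i
    have hlin : HasDerivAt (fun s : ℝ => b i * s) (b i) t := by
      simpa using (hasDerivAt_id t).const_mul (b i)
    exact ((hlin.sub hlin.sin).div_const _).const_mul _
  refine (HasDerivAt.fun_sum fun i _ => hd i).congr_deriv ?_
  rw [Fintype.sum_prod_type]
  refine Finset.sum_congr rfl fun i _ => ?_
  rw [Fin.sum_univ_two, Jbar_mulVec_xHat hb, Pi.sub_apply, Pi.sub_apply, (hHat_eq b t h i).1,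
    (hHat_eq b t h i).2]
  have hsc := Real.sin_sq_add_cos_sq (b i * t)
  have : (b i - Real.cos (b i * t) * b i) / (2 * b i) = (1 - Real.cos (b i * t)) / 2 := by
    field_simp [hb i]
  rw [this]
  linear_combination -(h (i, 0) ^ 2 + h (i, 1) ^ 2) / 2 * hsc

theorem zHat_zero (h : Hor n) : zHat b 0 h = 0 := by simp [zHat]

variable (b) in
/-- The variation of constants formula. -/
theorem hasDerivAt_duhamel {g : ℝ → Hor n} (hg : Continuous g) (t : ℝ) :
    HasDerivAt (fun τ => ∫ σ in (0 : ℝ)..τ, expJ b (τ - σ) *ᵥ g σ)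
      (Jbar b *ᵥ (∫ σ in (0 : ℝ)..t, expJ b (t - σ) *ᵥ g σ) + g t) t := by
  have hexp : ∀ i j, Continuous fun s => expJ b s i j := fun i j =>
    continuous_iff_continuousAt.2 fun t => (hasDerivAt_expJ_apply b t i j).continuousAt
  have hcont : Continuous fun σ => expJ b (-σ) *ᵥ g σ := by
    refine continuous_pi fun i => ?_
    refine continuous_finsetSum _ fun j _ => ?_
    exact ((hexp i j).comp continuous_neg).mul ((continuous_apply j).comp hg)
  -- With `expJ b τ` pulled out, `τ` remains only in the prefactor and in the endpoint, so the
  -- product rule and the fundamental theorem of calculus suffice.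
  have heq : ∀ τ, (∫ σ in (0 : ℝ)..τ, expJ b (τ - σ) *ᵥ g σ) =
      expJ b τ *ᵥ ∫ σ in (0 : ℝ)..τ, expJ b (-σ) *ᵥ g σ := by
    intro τ
    have := (LinearMap.toContinuousLinearMap (expJ b τ).mulVecLin).intervalIntegral_comp_comm
      (hcont.intervalIntegrable (μ := volume) 0 τ)
    refine Eq.trans (intervalIntegral.integral_congr fun σ _ => ?_) this
    simp [sub_eq_add_neg, expJ_add]
  have hint : HasDerivAt (fun τ => ∫ σ in (0 : ℝ)..τ, expJ b (-σ) *ᵥ g σ)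
      (expJ b (-t) *ᵥ g t) t :=
    intervalIntegral.integral_hasDerivAt_right (hcont.intervalIntegrable 0 t)
      (hcont.stronglyMeasurableAtFilter _ _) hcont.continuousAt
  have h := hasDerivAt_expJ_mulVec b hint
  rw [← heq t, Matrix.mulVec_mulVec, ← expJ_add, add_neg_cancel, expJ_zero,
    Matrix.one_mulVec] at h
  exact h.congr_of_eventuallyEq (Eventually.of_forall heq)

end Model

/-! ### Taylor expansion of a frame in normal form -/

section Frame

variable {n : ℕ}

theorem two_le_infty : (2 : WithTop ℕ∞) ≤ ∞ := WithTop.coe_le_coe.2 (le_top : (2 : ℕ∞) ≤ ⊤)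

theorem fst_eq_sum_dx (v : Hor n) : ((v, 0) : Coord n) = ∑ k, v k • dx k := by
  refine Prod.ext ?_ ?_
  · simp only [Prod.fst_sum, dx, Prod.smul_fst]
    ext j
    simp [Finset.sum_apply, Pi.single_apply]
  · simp [Prod.snd_sum, dx]

theorem coord_eq_sum (y : Coord n) : y = ∑ k, y.1 k • dx k + y.2 • dz n := by
  rw [← fst_eq_sum_dx]
  simp [dz]

theorem eventually_eq_zero_of_smul {f : ℝ → ℝ} (hf : ContinuousAt f 0)
    (h : ∀ᶠ s in 𝓝 (0 : ℝ), s * f s = 0) : f 0 = 0 := by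
  have h1 : ∀ᶠ s in 𝓝[≠] (0 : ℝ), f s = 0 := by
    filter_upwards [h.filter_mono nhdsWithin_le_nhds, self_mem_nhdsWithin] with s hs hs0
    exact (mul_eq_zero.1 hs).resolve_left hs0
  have h2 : Tendsto f (𝓝[≠] 0) (𝓝 0) :=
    tendsto_const_nhds.congr' (h1.mono fun s hs => hs.symm)
  exact tendsto_nhds_unique (hf.mono_left nhdsWithin_le_nhds) h2

theorem fderiv_apply_eq_zero_of_eventually {f : Coord n → ℝ} (hf : DifferentiableAt ℝ f 0)
    {v : Coord n} (h : ∀ᶠ s in 𝓝 (0 : ℝ), f (s • v) = 0) : fderiv ℝ f 0 v = 0 := by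
  have h1 : HasDerivAt (fun s : ℝ => s • v) v 0 := by
    simpa using (hasDerivAt_id (0 : ℝ)).smul_const v
  have h2 : HasFDerivAt f (fderiv ℝ f 0) ((0 : ℝ) • v) := by simpa using hf.hasFDerivAt
  have h3 := h2.comp_hasDerivAt (0 : ℝ) h1
  have h4 : HasDerivAt (f ∘ fun s : ℝ => s • v) 0 0 :=
    (hasDerivAt_const (0 : ℝ) (0 : ℝ)).congr_of_eventuallyEq h
  exact h3.unique h4

theorem tendsto_smul_zero (v : Coord n) : Tendsto (fun s : ℝ => s • v) (𝓝 0) (𝓝 0) := by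
  have : Continuous fun s : ℝ => s • v := by fun_prop
  simpa using this.tendsto 0

/-- The first order consequences of a radial condition `∑ₗ f_l(x, z) x_l = 0`. -/
theorem radial_condition {f : HIdx n → Coord n → ℝ} (hf : ∀ l, ContDiffAt ℝ 1 (f l) 0)
    (h : ∀ᶠ y in 𝓝 (0 : Coord n), ∑ l, f l y * y.1 l = 0) :
    (∀ l, f l 0 = 0) ∧ (∀ l, fderiv ℝ (f l) 0 (dz n) = 0) ∧
      ∀ l m, fderiv ℝ (f l) 0 (dx m) + fderiv ℝ (f m) 0 (dx l) = 0 := by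
  have hd : ∀ l, DifferentiableAt ℝ (f l) 0 := fun l => (hf l).differentiableAt one_ne_zero
  -- At `t ∂_z + s ∂_{x_l}` the radial sum has the single term `s * f l`; divide by `s` and let `s →
  -- 0`.
  have hax : ∀ l, ∀ᶠ t in 𝓝 (0 : ℝ), f l (t • dz n) = 0 := by
    intro l
    have hc : ∀ᶠ y in 𝓝 (0 : Coord n), ContinuousAt (f l) y :=
      ((hf l).eventually (by simp)).mono fun y hy => hy.continuousAt
    filter_upwards [(tendsto_smul_zero (dz n)).eventually (h.eventually_nhds.and hc)] with t ht
    have hcl : Continuous fun s : ℝ => t • dz n + s • dx l := by fun_prop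
    have hlim : Tendsto (fun s : ℝ => t • dz n + s • dx l) (𝓝 0) (𝓝 (t • dz n)) := by
      simpa using hcl.tendsto 0
    have hcont : ContinuousAt (fun s : ℝ => f l (t • dz n + s • dx l)) 0 :=
      ContinuousAt.comp (f := fun s : ℝ => t • dz n + s • dx l) (by simpa using ht.2)
        hcl.continuousAt
    have := eventually_eq_zero_of_smul hcont ?_
    · simpa using this
    · filter_upwards [hlim.eventually ht.1] with s hs
      simpa [dz, dx, Pi.single_apply, mul_comm] using hs
  have h0 : ∀ l, f l 0 = 0 := fun l => by simpa using (hax l).self_of_nhds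
  refine ⟨h0, fun l => fderiv_apply_eq_zero_of_eventually (hd l) (hax l), ?_⟩
  -- At `(s v, 0)` a factor `s` comes out of the radial sum. Differentiating the quotient at `s = 0`
  -- gives a vanishing quadratic form in `v`, which is polarized below.
  have hB : ∀ v : Hor n, ∑ l, fderiv ℝ (f l) 0 (v, 0) * v l = 0 := by
    intro v
    have hdv : DifferentiableAt ℝ (fun y => ∑ l, f l y * v l) 0 := by
      fun_prop (disch := exact hd _)
    have hev : ∀ᶠ s in 𝓝 (0 : ℝ), ∑ l, f l (s • ((v, 0) : Coord n)) * v l = 0 := by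
      filter_upwards [(tendsto_smul_zero ((v, 0) : Coord n)).eventually h] with s hs
      by_cases hs0 : s = 0
      · simp [hs0, h0]
      · refine (mul_eq_zero.1 (?_ : s * _ = 0)).resolve_left hs0
        refine Eq.trans ?_ hs
        rw [Finset.mul_sum]
        refine Finset.sum_congr rfl fun l _ => ?_
        simp only [Prod.smul_mk, Pi.smul_apply, smul_eq_mul]
        ring
    have key := fderiv_apply_eq_zero_of_eventually hdv hev
    have hfd : HasFDerivAt (fun y => ∑ l, f l y * v l) (∑ l, v l • fderiv ℝ (f l) 0) 0 :=
      HasFDerivAt.fun_sum fun l _ => (hd l).hasFDerivAt.mul_const (v l)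
    rw [hfd.fderiv] at key
    simpa [sum_apply, mul_comm] using key
  have hs : ∀ (w : Coord n) (m : HIdx n),
      ∑ l, fderiv ℝ (f l) 0 w * (Pi.single m 1 : Hor n) l = fderiv ℝ (f m) 0 w := by
    intro w m
    simp [Pi.single_apply]
  intro l m
  have e1 := hB (Pi.single l 1 + Pi.single m 1)
  have e2 := hB (Pi.single l 1)
  have e3 := hB (Pi.single m 1)
  have e4 : ((Pi.single l 1 + Pi.single m 1, 0) : Coord n) = dx l + dx m := by simp [dx]
  simp only [e4, map_add, Pi.add_apply, mul_add, add_mul, Finset.sum_add_distrib, hs] at e1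
  change ∑ l', fderiv ℝ (f l') 0 (dx l) * _ = 0 at e2
  change ∑ l', fderiv ℝ (f l') 0 (dx m) * _ = 0 at e3
  rw [hs] at e2 e3
  linarith

/-- A frame `X_1, …, X_{2n}` near the origin of `ℝ^{2n+1}`, with the symmetries of the
Agrachev–Gauthier normal form and with nilpotent invariants `b`. -/
structure IsNormalFrame (X : HIdx n → Coord n → Coord n) (b : Fin n → ℝ) : Prop where
  contDiffAt : ∀ k, ContDiffAt ℝ ∞ (X k) 0
  hor_symm : ∀ᶠ y in 𝓝 (0 : Coord n), ∀ k l, (X k y).1 l = (X l y).1 k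
  hor_radial : ∀ᶠ y in 𝓝 (0 : Coord n), ∀ k, ∑ l, (X l y).1 k * y.1 l = y.1 k
  vert_radial : ∀ᶠ y in 𝓝 (0 : Coord n), ∑ l, (X l y).2 * y.1 l = 0
  bracket : ∀ k l, ∃ c : HIdx n → ℝ,
    VectorField.lieBracket ℝ (X l) (X k) 0 = (∑ m, c m • X m 0) + Jbar b k l • dz n

/-- The matrix `J^{(1)}(y)` of a frame. -/
noncomputable def frameJ1 (X : HIdx n → Coord n → Coord n) (y : Hor n) :
    Matrix (HIdx n) (HIdx n) ℝ := fun i j =>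
  ∑ k, (pdx j (pdx k fun u => (X i u).2) 0 - pdx i (pdx k fun u => (X j u).2) 0) * y k

variable {X : HIdx n → Coord n → Coord n} {b : Fin n → ℝ}

namespace IsNormalFrame

theorem differentiableAt (hX : IsNormalFrame X b) (k : HIdx n) : DifferentiableAt ℝ (X k) 0 :=
  (hX.contDiffAt k).differentiableAt (by simp)

theorem fderiv_hor (hX : IsNormalFrame X b) (k l : HIdx n) (v : Coord n) :
    fderiv ℝ (fun y => (X k y).1 l) 0 v = (fderiv ℝ (X k) 0 v).1 l := by
  have h := (hX.differentiableAt k).hasFDerivAt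
  have h1 := (hasFDerivAt_pi'.1 h.fst) l
  rw [h1.fderiv]
  rfl

theorem fderiv_vert (hX : IsNormalFrame X b) (k : HIdx n) (v : Coord n) :
    fderiv ℝ (fun y => (X k y).2) 0 v = (fderiv ℝ (X k) 0 v).2 := by
  have h := (hX.differentiableAt k).hasFDerivAt
  rw [h.snd.fderiv]
  rfl

theorem hor_radial_condition (hX : IsNormalFrame X b) (k : HIdx n) :
    (∀ l, (X l 0).1 k - (if l = k then 1 else 0) = 0) ∧
      (∀ l, (fderiv ℝ (X l) 0 (dz n)).1 k = 0) ∧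
      ∀ l m, (fderiv ℝ (X l) 0 (dx m)).1 k + (fderiv ℝ (X m) 0 (dx l)).1 k = 0 := by
  have h := radial_condition (f := fun l y => (X l y).1 k - (if l = k then 1 else 0))
    (fun l => by
      have h1 := (hX.contDiffAt l).of_le (m := 1) (by simp)
      have h2 : ContDiffAt ℝ 1 (fun y => (X l y).1 k) 0 := (contDiffAt_pi.1 h1.fst) k
      exact h2.sub contDiffAt_const)
    (by
      filter_upwards [hX.hor_radial] with y hy
      simp [sub_mul, Finset.sum_sub_distrib, hy k])
  simpa only [fderiv_sub_const, hX.fderiv_hor] using h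

theorem vert_radial_condition (hX : IsNormalFrame X b) :
    (∀ l, (X l 0).2 = 0) ∧ (∀ l, (fderiv ℝ (X l) 0 (dz n)).2 = 0) ∧
      ∀ l m, (fderiv ℝ (X l) 0 (dx m)).2 + (fderiv ℝ (X m) 0 (dx l)).2 = 0 := by
  have h := radial_condition (f := fun l y => (X l y).2)
    (fun l => ((hX.contDiffAt l).of_le (m := 1) (by simp)).snd) hX.vert_radial
  simpa only [hX.fderiv_vert] using h

theorem apply_zero (hX : IsNormalFrame X b) (k : HIdx n) : X k 0 = dx k := by
  refine Prod.ext ?_ (hX.vert_radial_condition.1 k)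
  ext l
  have := (hX.hor_radial_condition l).1 k
  rw [sub_eq_zero] at this
  rw [this]
  simp [dx, Pi.single_apply, eq_comm]

theorem fderiv_apply_dz (hX : IsNormalFrame X b) (k : HIdx n) : fderiv ℝ (X k) 0 (dz n) = 0 :=
  Prod.ext (funext fun l => (hX.hor_radial_condition l).2.1 k) (hX.vert_radial_condition.2.1 k)

/-- The tensor `∂_m (X_k)_l` is symmetric in `k, l` by `hor_symm` and antisymmetric in `k, m` by the
radial condition; a tensor with both symmetries is zero. -/
theorem fderiv_apply_dx_fst (hX : IsNormalFrame X b) (k m : HIdx n) :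
    (fderiv ℝ (X k) 0 (dx m)).1 = 0 := by
  have hs : ∀ k l m, (fderiv ℝ (X k) 0 (dx m)).1 l = (fderiv ℝ (X l) 0 (dx m)).1 k := by
    intro k l m
    rw [← hX.fderiv_hor, ← hX.fderiv_hor]
    have : (fun y => (X k y).1 l) =ᶠ[𝓝 0] fun y => (X l y).1 k :=
      hX.hor_symm.mono fun y hy => hy k l
    rw [this.fderiv_eq]
  have ha := fun k l m => (hX.hor_radial_condition k).2.2 l m
  ext l
  have h1 := ha l k m
  have h2 := ha k m l
  have h3 := ha m l k
  simp only [Pi.zero_apply]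
  linarith [hs k l m, hs m l k, hs m k l]

/-- The radial condition makes this matrix antisymmetric, and the vertical part of the bracket at
the origin is twice it. The unknown coefficients `c` drop out because every `X m 0` is horizontal.
-/
theorem fderiv_apply_dx_snd (hX : IsNormalFrame X b) (k l : HIdx n) :
    (fderiv ℝ (X k) 0 (dx l)).2 = (1 / 2) * Jbar b k l := by
  obtain ⟨c, hc⟩ := hX.bracket k l
  have h := congrArg Prod.snd hc
  simp only [VectorField.lieBracket, hX.apply_zero, Prod.snd_sub, Prod.snd_add, Prod.snd_sum,
    Prod.smul_snd] at h
  have := hX.vert_radial_condition.2.2 k l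
  simp [dx, dz] at h
  simp only [dx] at this ⊢
  linarith

theorem fderiv_apply (hX : IsNormalFrame X b) (k : HIdx n) (v : Coord n) :
    fderiv ℝ (X k) 0 v = (0, (1 / 2) * (Jbar b *ᵥ v.1) k) := by
  conv_lhs => rw [coord_eq_sum v]
  rw [map_add, map_sum, map_smul, hX.fderiv_apply_dz, smul_zero, add_zero]
  simp only [map_smul]
  refine Prod.ext ?_ ?_
  · simp [Prod.fst_sum, hX.fderiv_apply_dx_fst]
  · simp only [Prod.snd_sum, Prod.smul_snd, hX.fderiv_apply_dx_snd, Matrix.mulVec, dotProduct,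
      smul_eq_mul, Finset.mul_sum]
    exact Finset.sum_congr rfl fun l _ => by ring

theorem isBigO_frame (hX : IsNormalFrame X b) (k : HIdx n) :
    (fun y => X k y - dx k - (0, (1 / 2) * (Jbar b *ᵥ y.1) k)) =O[𝓝 0] fun y => ‖y‖ ^ 2 := by
  have h := isBigO_taylor_of_contDiffAt_two ((hX.contDiffAt k).of_le (m := 2) two_le_infty)
  simpa only [hX.apply_zero, hX.fderiv_apply] using h

theorem contDiffAt_fderiv (hX : IsNormalFrame X b) (k : HIdx n) :
    ContDiffAt ℝ ∞ (fderiv ℝ (X k)) 0 :=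
  (hX.contDiffAt k).fderiv_right (by simp)

theorem isBigO_fderiv_dz (hX : IsNormalFrame X b) (k : HIdx n) :
    (fun y => fderiv ℝ (X k) y (dz n)) =O[𝓝 0] fun y => ‖y‖ ^ 1 := by
  have h := isBigO_sub_of_contDiffAt_one (f := fun y => fderiv ℝ (X k) y (dz n))
    (((hX.contDiffAt_fderiv k).of_le (by simp)).clm_apply contDiffAt_const)
  simpa only [hX.fderiv_apply_dz, sub_zero] using h

theorem contDiffAt_bracket (hX : IsNormalFrame X b) (k l : HIdx n) :
    ContDiffAt ℝ ∞ (VectorField.lieBracket ℝ (X l) (X k)) 0 :=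
  ((hX.contDiffAt_fderiv k).clm_apply (hX.contDiffAt l)).sub
    ((hX.contDiffAt_fderiv l).clm_apply (hX.contDiffAt k))

theorem bracket_zero (hX : IsNormalFrame X b) (k l : HIdx n) :
    VectorField.lieBracket ℝ (X l) (X k) 0 = (0, Jbar b k l) := by
  simp only [VectorField.lieBracket, hX.apply_zero]
  refine Prod.ext ?_ ?_
  · simp [hX.fderiv_apply_dx_fst]
  · simp only [Prod.snd_sub, hX.fderiv_apply_dx_snd, Jbar_antisymm b l k]
    ring

theorem isBigO_bracket_fst (hX : IsNormalFrame X b) (k l : HIdx n) :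
    (fun y => (VectorField.lieBracket ℝ (X l) (X k) y).1) =O[𝓝 0] fun y => ‖y‖ ^ 1 := by
  have h := isBigO_sub_of_contDiffAt_one
    (f := fun y => (VectorField.lieBracket ℝ (X l) (X k) y).1)
    ((hX.contDiffAt_bracket k l).of_le (by simp)).fst
  simpa only [hX.bracket_zero, sub_zero] using h

theorem pdx_pdx (hX : IsNormalFrame X b) (k l m : HIdx n) :
    pdx l (pdx m fun u => (X k u).2) 0 = (fderiv ℝ (fderiv ℝ (X k)) 0 (dx m) (dx l)).2 := by
  have hev : (pdx m fun u => (X k u).2) =ᶠ[𝓝 0] fun u => (fderiv ℝ (X k) u (dx m)).2 := by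
    filter_upwards [((hX.contDiffAt k).of_le two_le_infty).eventually (by simp)] with u hu
    rw [pdx, ((hu.differentiableAt two_ne_zero).hasFDerivAt.snd).fderiv]
    rfl
  have hd : HasFDerivAt (fderiv ℝ (X k)) (fderiv ℝ (fderiv ℝ (X k)) 0) 0 :=
    ((hX.contDiffAt_fderiv k).differentiableAt (by simp)).hasFDerivAt
  have hs : IsSymmSndFDerivAt ℝ (X k) 0 := (hX.contDiffAt k).isSymmSndFDerivAt (by simpa using two_le_infty)
  rw [pdx, hev.fderiv_eq, ((hd.clm_apply (hasFDerivAt_const (dx m) 0)).snd).fderiv]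
  rw [hs.eq (dx m) (dx l)]
  simp

/-- The products of two first derivatives vanish: at the origin the first derivatives of the frame
take vertical values and annihilate vertical vectors. Only second derivatives remain, and these are
what `frameJ1` collects. -/
theorem fderiv_bracket_snd (hX : IsNormalFrame X b) (k l : HIdx n) (v : Coord n) :
    fderiv ℝ (fun y => (VectorField.lieBracket ℝ (X l) (X k) y).2) 0 v =
      (fderiv ℝ (fderiv ℝ (X k)) 0 v (dx l)).2 - (fderiv ℝ (fderiv ℝ (X l)) 0 v (dx k)).2 := by
  have hd : ∀ k, HasFDerivAt (fderiv ℝ (X k)) (fderiv ℝ (fderiv ℝ (X k)) 0) 0 := fun k =>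
    ((hX.contDiffAt_fderiv k).differentiableAt (by simp)).hasFDerivAt
  have hf : ∀ k, HasFDerivAt (X k) (fderiv ℝ (X k) 0) 0 := fun k =>
    (hX.differentiableAt k).hasFDerivAt
  have h := (((hd k).clm_apply (hf l)).sub ((hd l).clm_apply (hf k))).snd
  have : fderiv ℝ (fun y => (VectorField.lieBracket ℝ (X l) (X k) y).2) 0 = _ := h.fderiv
  rw [this]
  simp [hX.apply_zero, hX.fderiv_apply]

/-- The coefficient `c` of `z` need not be identified, since `z` is itself of second order along the
solutions. -/
theorem isBigO_bracket_snd (hX : IsNormalFrame X b) (k l : HIdx n) : ∃ c : ℝ,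
    (fun y => (VectorField.lieBracket ℝ (X l) (X k) y).2 - Jbar b k l - frameJ1 X y.1 k l -
      y.2 * c) =O[𝓝 0] fun y => ‖y‖ ^ 2 := by
  refine ⟨fderiv ℝ (fun y => (VectorField.lieBracket ℝ (X l) (X k) y).2) 0 (dz n), ?_⟩
  have h := isBigO_taylor_of_contDiffAt_two
    (f := fun y => (VectorField.lieBracket ℝ (X l) (X k) y).2)
    ((hX.contDiffAt_bracket k l).of_le (m := 2) two_le_infty).snd
  refine h.congr_left fun y => ?_
  have hy : fderiv ℝ (fun y => (VectorField.lieBracket ℝ (X l) (X k) y).2) 0 y =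
      frameJ1 X y.1 k l +
        y.2 * fderiv ℝ (fun y => (VectorField.lieBracket ℝ (X l) (X k) y).2) 0 (dz n) := by
    conv_lhs => rw [coord_eq_sum y]
    rw [map_add, map_sum, map_smul, smul_eq_mul]
    congr 1
    simp only [map_smul, hX.fderiv_bracket_snd, frameJ1, hX.pdx_pdx, smul_apply, Prod.smul_snd,
      smul_eq_mul]
    exact Finset.sum_congr rfl fun m _ => by ring
  rw [hy, hX.bracket_zero]
  ring

end IsNormalFrame

end Frame

/-! ### The Hamiltonian vector field of a frame -/

section Dynamics

variable {n : ℕ}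

/-- The Hamiltonian vector field of `1/2 ∑ₖ ⟨p, X_k⟩²` on `T^*ℝ^{2n+1}`. -/
noncomputable def hamField (X : HIdx n → Coord n → Coord n)
    (u : Coord n × (Coord n →L[ℝ] ℝ)) : Coord n × (Coord n →L[ℝ] ℝ) :=
  (∑ k, u.2 (X k u.1) • X k u.1, -∑ k, u.2 (X k u.1) • u.2.comp (fderiv ℝ (X k) u.1))

/-- The covector `dz` at the origin. -/
noncomputable def restPoint (n : ℕ) : Coord n × (Coord n →L[ℝ] ℝ) :=
  (0, ContinuousLinearMap.snd ℝ (Hor n) ℝ)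

/-- The covector `∑ₖ h_k dx_k`. -/
noncomputable def horCov (h : Hor n) : Coord n →L[ℝ] ℝ :=
  ∑ k, h k • (ContinuousLinearMap.proj k).comp (ContinuousLinearMap.fst ℝ (Hor n) ℝ)

theorem horCov_apply (h : Hor n) (y : Coord n) : horCov h y = ∑ k, h k * y.1 k := by
  simp [horCov, sum_apply]

/-- The covector `dz + η ∑ₖ h_k dx_k` at the origin. -/
noncomputable def startPoint (η : ℝ) (h : Hor n) : Coord n × (Coord n →L[ℝ] ℝ) :=
  (0, ContinuousLinearMap.snd ℝ (Hor n) ℝ + η • horCov h)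

variable {X : HIdx n → Coord n → Coord n} {b : Fin n → ℝ}

theorem hamField_restPoint (hX : IsNormalFrame X b) : hamField X (restPoint n) = 0 := by
  simp [hamField, restPoint, hX.apply_zero, dx]

theorem contDiffAt_hamField {u : Coord n × (Coord n →L[ℝ] ℝ)}
    (hX : ∀ k, ContDiffAt ℝ ∞ (X k) u.1) : ContDiffAt ℝ 1 (hamField X) u := by
  have h1 : ∀ k, ContDiffAt ℝ 1 (fun u : Coord n × (Coord n →L[ℝ] ℝ) => X k u.1) u := fun k =>
    ((hX k).of_le (by simp)).comp u contDiffAt_fst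
  have h2 : ∀ k, ContDiffAt ℝ 1
      (fun u : Coord n × (Coord n →L[ℝ] ℝ) => fderiv ℝ (X k) u.1) u := fun k =>
    (((hX k).fderiv_right (m := ∞) (by simp)).of_le (by simp)).comp u contDiffAt_fst
  have h3 : ∀ k, ContDiffAt ℝ 1 (fun u : Coord n × (Coord n →L[ℝ] ℝ) => u.2 (X k u.1)) u :=
    fun k => contDiffAt_snd.clm_apply (h1 k)
  refine ContDiffAt.prodMk (ContDiffAt.sum fun k _ => (h3 k).smul (h1 k))
    (ContDiffAt.sum fun k _ => (h3 k).smul (contDiffAt_snd.clm_comp (h2 k))).neg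

/-- The Poisson bracket of `H` with a linear momentum: the motion of the covector and the motion of
the base point supply the two halves of the Lie bracket. -/
theorem hasDerivWithinAt_momentum {u : ℝ → Coord n × (Coord n →L[ℝ] ℝ)} {s : Set ℝ} {t : ℝ}
    (hu : HasDerivWithinAt u (hamField X (u t)) s t) (k : HIdx n)
    (hX : DifferentiableAt ℝ (X k) (u t).1) :
    HasDerivWithinAt (fun r => (u r).2 (X k (u r).1))
      (∑ l, (u t).2 (X l (u t).1) *
        (u t).2 (VectorField.lieBracket ℝ (X l) (X k) (u t).1)) s t := by
  have h1 : HasDerivWithinAt (fun r => (u r).1) (hamField X (u t)).1 s t := by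
    simpa using (hu.hasFDerivWithinAt.fst).hasDerivWithinAt
  have h2 : HasDerivWithinAt (fun r => (u r).2) (hamField X (u t)).2 s t := by
    simpa using (hu.hasFDerivWithinAt.snd).hasDerivWithinAt
  refine (h2.clm_apply (hX.hasFDerivAt.comp_hasDerivWithinAt t h1)).congr_deriv ?_
  simp only [hamField, neg_apply, sum_apply, smul_apply, ContinuousLinearMap.comp_apply,
    smul_eq_mul, map_sum, map_smul, VectorField.lieBracket, map_sub, mul_sub,
    Finset.sum_sub_distrib, Function.comp_apply]
  ring

end Dynamics

/-! ### Arithmetic of uniform orders in `η` -/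

section Calculus

variable {β : Type*} {B : Set β} {T : ℝ}

theorem isBigO_unif_mono {E : Type*} [Norm E] {f : ℝ × β × ℝ → E} {k m : ℕ}
    (hf : f =O[unif B T] (fun p => p.1 ^ k)) (h : m ≤ k) :
    f =O[unif B T] (fun p => p.1 ^ m) :=
  hf.trans (isBigO_unif_pow_le h)

theorem isBigO_unif_mul {f g : ℝ × β × ℝ → ℝ} {j m k : ℕ}
    (hf : f =O[unif B T] (fun p => p.1 ^ j)) (hg : g =O[unif B T] (fun p => p.1 ^ m))
    (h : j + m = k) : (fun p => f p * g p) =O[unif B T] (fun p => p.1 ^ k) := by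
  subst h
  simpa only [pow_add] using hf.mul hg

theorem isBigO_unif_smul {E : Type*} [NormedAddCommGroup E] [NormedSpace ℝ E]
    {f : ℝ × β × ℝ → ℝ} {g : ℝ × β × ℝ → E} {j m k : ℕ}
    (hf : f =O[unif B T] (fun p => p.1 ^ j)) (hg : g =O[unif B T] (fun p => p.1 ^ m))
    (h : j + m = k) : (fun p => f p • g p) =O[unif B T] (fun p => p.1 ^ k) := by
  subst h
  simpa only [pow_add, smul_eq_mul] using hf.smul hg

theorem isBigO_unif_clm_apply {E : Type*} [NormedAddCommGroup E] [NormedSpace ℝ E]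
    {f : ℝ × β × ℝ → (E →L[ℝ] ℝ)} {g : ℝ × β × ℝ → E} {j m k : ℕ}
    (hf : f =O[unif B T] (fun p => p.1 ^ j)) (hg : g =O[unif B T] (fun p => p.1 ^ m))
    (h : j + m = k) : (fun p => f p (g p)) =O[unif B T] (fun p => p.1 ^ k) := by
  subst h
  have h1 : (fun p => f p (g p)) =O[unif B T] fun p => ‖f p‖ * ‖g p‖ :=
    IsBigO.of_bound 1 (Eventually.of_forall fun p => by
      simpa using (f p).le_opNorm (g p))
  simpa only [pow_add] using h1.trans (hf.norm_left.mul hg.norm_left)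

variable {n : ℕ}

theorem isBigO_unif_mulVec {A : ℝ × β × ℝ → Matrix (HIdx n) (HIdx n) ℝ}
    {g : ℝ × β × ℝ → Hor n} {j m k : ℕ}
    (hA : ∀ i l, (fun p => A p i l) =O[unif B T] (fun p => p.1 ^ j))
    (hg : g =O[unif B T] (fun p => p.1 ^ m)) (h : j + m = k) :
    (fun p => A p *ᵥ g p) =O[unif B T] (fun p => p.1 ^ k) :=
  isBigO_pi.2 fun i => IsBigO.fun_sum fun l _ => isBigO_unif_mul (hA i l) (isBigO_pi.1 hg l) h

theorem isBigO_unif_const {E : Type*} [NormedAddCommGroup E] (c : E) :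
    (fun _ : ℝ × β × ℝ => c) =O[unif B T] (fun p => p.1 ^ 0) := by
  simpa using isBigO_const_const c (one_ne_zero (α := ℝ)) (unif B T)

theorem isBigO_unif_frameJ1 (X : HIdx n → Coord n → Coord n) {g : ℝ × β × ℝ → Hor n} {m : ℕ}
    (hg : g =O[unif B T] (fun p => p.1 ^ m)) (i l : HIdx n) :
    (fun p => frameJ1 X (g p) i l) =O[unif B T] (fun p => p.1 ^ m) :=
  IsBigO.fun_sum fun k _ => isBigO_unif_mul (isBigO_unif_const _) (isBigO_pi.1 hg k) (zero_add m)

/-- Turns Taylor remainders at the origin into powers of `η` along base curves of size `O(η)`. -/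
theorem isBigO_unif_comp {E F : Type*} [NormedAddCommGroup E] [Norm F]
    {f : E → F} {y : ℝ × β × ℝ → E} {k : ℕ} (hf : f =O[𝓝 0] fun y => ‖y‖ ^ k)
    (hy : y =O[unif B T] (fun p => p.1 ^ 1)) :
    (fun p => f (y p)) =O[unif B T] (fun p => p.1 ^ k) := by
  have h0 : Tendsto y (unif B T) (𝓝 0) :=
    hy.trans_tendsto (by simpa using (tendsto_unif_fst (B := B) (T := T)).pow 1)
  simp only [pow_one] at hy
  exact (hf.comp_tendsto h0).trans (hy.norm_left.pow k)

end Calculus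

/-! ### Expansion of the solutions -/

section Expansion

variable {n : ℕ} {X : HIdx n → Coord n → Coord n} {b : Fin n → ℝ} {B : Set (Hor n)} {T : ℝ}

/-- The first order term of the momenta. -/
noncomputable def frameH1 (X : HIdx n → Coord n → Coord n) (b : Fin n → ℝ) (τ : ℝ) (h : Hor n) :
    Hor n :=
  ∫ σ in (0 : ℝ)..τ, expJ b (τ - σ) *ᵥ (frameJ1 X (xHat b σ h) *ᵥ hHat b σ h)

/-- A family of solutions `u(η, h, ·)` of Hamilton's equations on `[0, T]`, which starts at
`startPoint η h` and stays at distance `O(η)` of the equilibrium. -/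
structure IsSolutionFamily (X : HIdx n → Coord n → Coord n) (B : Set (Hor n)) (T : ℝ)
    (u : ℝ × Hor n × ℝ → Coord n × (Coord n →L[ℝ] ℝ)) : Prop where
  init : ∀ᶠ η in 𝓝[>] (0 : ℝ), ∀ h ∈ B, u (η, h, 0) = startPoint η h
  deriv : ∀ᶠ η in 𝓝[>] (0 : ℝ), ∀ h ∈ B, ∀ τ ∈ Icc 0 T,
    HasDerivWithinAt (fun s => u (η, h, s)) (hamField X (u (η, h, τ))) (Icc 0 T) τ
  near : (fun p => u p - restPoint n) =O[unif B T] (fun p => p.1 ^ 1)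

theorem continuous_frameJ1_mulVec (hb : ∀ i, b i ≠ 0) (h : Hor n) :
    Continuous fun σ => frameJ1 X (xHat b σ h) *ᵥ hHat b σ h := by
  refine continuous_pi fun i => continuous_finsetSum _ fun j _ => Continuous.mul ?_ ?_
  · exact continuous_finsetSum _ fun k _ => continuous_const.mul
      ((continuous_apply k).comp (continuous_xHat hb h))
  · exact (continuous_apply j).comp (continuous_hHat b h)

theorem hasDerivAt_frameH1 (hb : ∀ i, b i ≠ 0) (t : ℝ) (h : Hor n) :
    HasDerivAt (fun τ => frameH1 X b τ h)
      (Jbar b *ᵥ frameH1 X b t h + frameJ1 X (xHat b t h) *ᵥ hHat b t h) t :=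
  hasDerivAt_duhamel b (continuous_frameJ1_mulVec hb h) t

theorem frameJ1_sub_smul (x y : Hor n) (c : ℝ) (i l : HIdx n) :
    frameJ1 X (x - c • y) i l = frameJ1 X x i l - c * frameJ1 X y i l := by
  simp only [frameJ1, Pi.sub_apply, Pi.smul_apply, smul_eq_mul, mul_sub, Finset.sum_sub_distrib,
    Finset.mul_sum]
  congr 1
  exact Finset.sum_congr rfl fun k _ => by ring

/-- The momenta `⟨p, X_k⟩`. -/
noncomputable def momenta (X : HIdx n → Coord n → Coord n)
    (u : Coord n × (Coord n →L[ℝ] ℝ)) : Hor n :=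
  fun k => u.2 (X k u.1)

/-- `J̄` as a continuous linear map. -/
noncomputable def JbarL (b : Fin n → ℝ) : Hor n →L[ℝ] Hor n :=
  LinearMap.toContinuousLinearMap (Jbar b).mulVecLin

theorem JbarL_apply (v : Hor n) : JbarL b v = Jbar b *ᵥ v := rfl

namespace IsSolutionFamily

variable {u : ℝ × Hor n × ℝ → Coord n × (Coord n →L[ℝ] ℝ)}

theorem isBigO_base (hu : IsSolutionFamily X B T u) :
    (fun p => (u p).1) =O[unif B T] (fun p => p.1 ^ 1) := by
  simpa [restPoint] using hu.near.prod_left_fst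

theorem isBigO_cov_sub (hu : IsSolutionFamily X B T u) :
    (fun p => (u p).2 - ContinuousLinearMap.snd ℝ (Hor n) ℝ) =O[unif B T] (fun p => p.1 ^ 1) := by
  simpa [restPoint] using hu.near.prod_left_snd

theorem isBigO_cov (hu : IsSolutionFamily X B T u) :
    (fun p => (u p).2) =O[unif B T] (fun p => p.1 ^ 0) := by
  simpa using (isBigO_unif_mono hu.isBigO_cov_sub zero_le_one).add
    (isBigO_unif_const (ContinuousLinearMap.snd ℝ (Hor n) ℝ))

theorem tendsto_base (hu : IsSolutionFamily X B T u) :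
    Tendsto (fun p => (u p).1) (unif B T) (𝓝 0) :=
  hu.isBigO_base.trans_tendsto (by simpa using (tendsto_unif_fst (B := B) (T := T)).pow 1)

theorem isBigO_bounded {E : Type*} [NormedAddCommGroup E] (hu : IsSolutionFamily X B T u)
    {f : Coord n → E} (hf : ContinuousAt f 0) :
    (fun p => f (u p).1) =O[unif B T] (fun p => p.1 ^ 0) := by
  simpa using (hf.tendsto.comp hu.tendsto_base).isBigO_one ℝ

theorem isBigO_vert (hX : IsNormalFrame X b) (hu : IsSolutionFamily X B T u) (k : HIdx n) :
    (fun p => (X k (u p).1).2 - (1 / 2) * (Jbar b *ᵥ (u p).1.1) k) =O[unif B T]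
      (fun p => p.1 ^ 2) := by
  simpa [dx] using (isBigO_unif_comp (hX.isBigO_frame k) hu.isBigO_base).prod_left_snd

theorem isBigO_hor (hX : IsNormalFrame X b) (hu : IsSolutionFamily X B T u) (k : HIdx n) :
    (fun p => (X k (u p).1).1 - Pi.single k 1) =O[unif B T] (fun p => p.1 ^ 2) := by
  simpa [dx] using (isBigO_unif_comp (hX.isBigO_frame k) hu.isBigO_base).prod_left_fst

theorem isBigO_mulVec_hor (hu : IsSolutionFamily X B T u) (A : Matrix (HIdx n) (HIdx n) ℝ) :
    (fun p => A *ᵥ (u p).1.1) =O[unif B T] (fun p => p.1 ^ 1) :=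
  isBigO_unif_mulVec (fun _ _ => isBigO_unif_const _) hu.isBigO_base.prod_left_fst (zero_add 1)

theorem isBigO_vert_one (hX : IsNormalFrame X b) (hu : IsSolutionFamily X B T u) (k : HIdx n) :
    (fun p => (X k (u p).1).2) =O[unif B T] (fun p => p.1 ^ 1) := by
  have h1 := isBigO_unif_mul (isBigO_unif_const (1 / 2 : ℝ))
    (isBigO_pi.1 (hu.isBigO_mulVec_hor (Jbar b)) k) (zero_add 1)
  simpa using (isBigO_unif_mono (hu.isBigO_vert hX k) one_le_two).add h1

/-- The covector is `dz + O(η)`, the frame is bounded near the origin, and `dz` sees only the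
vertical component of the frame, which is `O(η)`. -/
theorem isBigO_momenta (hX : IsNormalFrame X b) (hu : IsSolutionFamily X B T u) :
    (fun p => momenta X (u p)) =O[unif B T] (fun p => p.1 ^ 1) := by
  refine isBigO_pi.2 fun k => ?_
  have h1 := isBigO_unif_clm_apply hu.isBigO_cov_sub
    (hu.isBigO_bounded (hX.contDiffAt k).continuousAt) (add_zero 1)
  simpa [momenta] using h1.add (hu.isBigO_vert_one hX k)

theorem hasDerivWithinAt_base (hu : IsSolutionFamily X B T u) :
    ∀ᶠ η in 𝓝[>] (0 : ℝ), ∀ h ∈ B, ∀ τ ∈ Icc 0 T,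
      HasDerivWithinAt (fun s => (u (η, h, s)).1) (hamField X (u (η, h, τ))).1 (Icc 0 T) τ := by
  filter_upwards [hu.deriv] with η hη h hh τ hτ
  simpa using ((hη h hh τ hτ).hasFDerivWithinAt.fst).hasDerivWithinAt

theorem hasDerivWithinAt_cov (hu : IsSolutionFamily X B T u) :
    ∀ᶠ η in 𝓝[>] (0 : ℝ), ∀ h ∈ B, ∀ τ ∈ Icc 0 T,
      HasDerivWithinAt (fun s => (u (η, h, s)).2) (hamField X (u (η, h, τ))).2 (Icc 0 T) τ := by
  filter_upwards [hu.deriv] with η hη h hh τ hτ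
  simpa using ((hη h hh τ hτ).hasFDerivWithinAt.snd).hasDerivWithinAt

theorem hasDerivWithinAt_hor (hu : IsSolutionFamily X B T u) :
    ∀ᶠ η in 𝓝[>] (0 : ℝ), ∀ h ∈ B, ∀ τ ∈ Icc 0 T,
      HasDerivWithinAt (fun s => (u (η, h, s)).1.1)
        (∑ k, momenta X (u (η, h, τ)) k • (X k (u (η, h, τ)).1).1) (Icc 0 T) τ := by
  filter_upwards [hu.hasDerivWithinAt_base] with η hη h hh τ hτ
  have := ((hη h hh τ hτ).hasFDerivWithinAt.fst).hasDerivWithinAt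
  simpa [hamField, momenta, Prod.fst_sum] using this

theorem hasDerivWithinAt_vert (hu : IsSolutionFamily X B T u) :
    ∀ᶠ η in 𝓝[>] (0 : ℝ), ∀ h ∈ B, ∀ τ ∈ Icc 0 T,
      HasDerivWithinAt (fun s => (u (η, h, s)).1.2)
        (∑ k, momenta X (u (η, h, τ)) k * (X k (u (η, h, τ)).1).2) (Icc 0 T) τ := by
  filter_upwards [hu.hasDerivWithinAt_base] with η hη h hh τ hτ
  have := ((hη h hh τ hτ).hasFDerivWithinAt.snd).hasDerivWithinAt
  simpa [hamField, momenta, Prod.snd_sum] using this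

/-- The order is `2` because the derivative is a sum of products of a momentum and `∂_z X_k`, and
the latter vanishes at the origin. -/
theorem isBigO_reeb (hX : IsNormalFrame X b) (hu : IsSolutionFamily X B T u) :
    (fun p => (u p).2 (dz n) - 1) =O[unif B T] (fun p => p.1 ^ 2) := by
  refine isBigO_unif_of_deriv_zero
    (f' := fun p => -∑ k, momenta X (u p) k * (u p).2 (fderiv ℝ (X k) (u p).1 (dz n))) ?_ ?_ ?_
  · filter_upwards [hu.init] with η hη h hh
    simp [hη h hh, startPoint, horCov_apply, dz]
  · filter_upwards [hu.hasDerivWithinAt_cov] with η hη h hh τ hτ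
    have := ((hη h hh τ hτ).clm_apply (hasDerivWithinAt_const τ _ (dz n))).sub_const 1
    simpa [hamField, momenta, sum_apply] using this
  · refine (IsBigO.fun_sum fun k _ => ?_).neg_left
    exact isBigO_unif_mul (isBigO_pi.1 (hu.isBigO_momenta hX) k)
      (isBigO_unif_clm_apply hu.isBigO_cov
        (isBigO_unif_comp (hX.isBigO_fderiv_dz k) hu.isBigO_base) (zero_add 1)) rfl

theorem isBigO_z (hX : IsNormalFrame X b) (hu : IsSolutionFamily X B T u) :
    (fun p => (u p).1.2) =O[unif B T] (fun p => p.1 ^ 2) := by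
  refine isBigO_unif_of_deriv_zero (f' := fun p => ∑ k, momenta X (u p) k * (X k (u p).1).2)
    ?_ hu.hasDerivWithinAt_vert ?_
  · filter_upwards [hu.init] with η hη h hh
    simp [hη h hh, startPoint]
  · exact IsBigO.fun_sum fun k _ => isBigO_unif_mul (isBigO_pi.1 (hu.isBigO_momenta hX) k)
      (hu.isBigO_vert_one hX k) rfl

theorem isBigO_bracket (hX : IsNormalFrame X b) (hu : IsSolutionFamily X B T u) (k l : HIdx n) :
    (fun p => (u p).2 (VectorField.lieBracket ℝ (X l) (X k) (u p).1) -
      (Jbar b k l + frameJ1 X (u p).1.1 k l)) =O[unif B T] (fun p => p.1 ^ 2) := by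
  obtain ⟨c, hc⟩ := hX.isBigO_bracket_snd k l
  set W := VectorField.lieBracket ℝ (X l) (X k) with hW
  -- Subtracting `dz` is free on a horizontal vector and gains a factor `η`; the horizontal part of
  -- the bracket, zero at the origin, gives the other.
  have h1 : (fun p => ((u p).2 - ContinuousLinearMap.snd ℝ (Hor n) ℝ)
      ((W (u p).1).1, 0)) =O[unif B T] (fun p => p.1 ^ 2) :=
    isBigO_unif_clm_apply hu.isBigO_cov_sub
      ((isBigO_unif_comp (hX.isBigO_bracket_fst k l) hu.isBigO_base).prod_left (isBigO_zero _ _))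
      rfl
  have h2 : (fun p => (W (u p).1).2 * ((u p).2 (dz n) - 1)) =O[unif B T] (fun p => p.1 ^ 2) :=
    isBigO_unif_mul (hu.isBigO_bounded (f := fun y => (W y).2)
      (hX.contDiffAt_bracket k l).continuousAt.snd) (hu.isBigO_reeb hX) (zero_add 2)
  have h3 := isBigO_unif_comp hc hu.isBigO_base
  have h4 := isBigO_unif_mul (hu.isBigO_z hX) (isBigO_unif_const c) (add_zero 2)
  refine (((h1.add h2).add h3).add h4).congr_left fun p => ?_
  have e : (u p).2 (W (u p).1) =
      (u p).2 ((W (u p).1).1, 0) + (W (u p).1).2 * (u p).2 (dz n) := by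
    rw [← smul_eq_mul, ← map_smul, ← map_add]
    simp [dz]
  rw [e]
  simp only [sub_apply, ContinuousLinearMap.coe_snd']
  ring

theorem hasDerivWithinAt_momenta (hX : IsNormalFrame X b) (hu : IsSolutionFamily X B T u) :
    ∀ᶠ η in 𝓝[>] (0 : ℝ), ∀ h ∈ B, ∀ τ ∈ Icc 0 T,
      HasDerivWithinAt (fun s => momenta X (u (η, h, s)))
        (fun k => ∑ l, momenta X (u (η, h, τ)) l *
          (u (η, h, τ)).2 (VectorField.lieBracket ℝ (X l) (X k) (u (η, h, τ)).1))
        (Icc 0 T) τ := by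
  have hd : ∀ᶠ y in 𝓝 (0 : Coord n), ∀ k, DifferentiableAt ℝ (X k) y := by
    rw [eventually_all]
    intro k
    filter_upwards [((hX.contDiffAt k).of_le two_le_infty).eventually (by simp)] with y hy
    exact hy.differentiableAt two_ne_zero
  filter_upwards [hu.deriv, eventually_unif.1 (hu.tendsto_base.eventually hd)]
    with η hη hdη h hh τ hτ
  exact hasDerivWithinAt_pi.2 fun k =>
    hasDerivWithinAt_momentum (hη h hh τ hτ) k (hdη h hh τ hτ k)

/-- The momenta satisfy `P' = (J̄ + J^{(1)}(x)) P + O(η³)`. -/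
theorem isBigO_momenta_deriv (hX : IsNormalFrame X b) (hu : IsSolutionFamily X B T u) :
    (fun p => (fun k => ∑ l, momenta X (u p) l *
      (u p).2 (VectorField.lieBracket ℝ (X l) (X k) (u p).1)) -
        (Jbar b *ᵥ momenta X (u p) + frameJ1 X (u p).1.1 *ᵥ momenta X (u p))) =O[unif B T]
      (fun p => p.1 ^ 3) := by
  refine isBigO_pi.2 fun k => ?_
  have h : (fun p => ∑ l, momenta X (u p) l *
      ((u p).2 (VectorField.lieBracket ℝ (X l) (X k) (u p).1) -
        (Jbar b k l + frameJ1 X (u p).1.1 k l))) =O[unif B T] (fun p => p.1 ^ 3) :=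
    IsBigO.fun_sum fun l _ => isBigO_unif_mul (isBigO_pi.1 (hu.isBigO_momenta hX) l)
      (hu.isBigO_bracket hX k l) rfl
  refine h.congr_left fun p => ?_
  simp only [Pi.sub_apply, Pi.add_apply, Matrix.mulVec, dotProduct, ← Finset.sum_add_distrib,
    ← Finset.sum_sub_distrib]
  exact Finset.sum_congr rfl fun l _ => by ring

theorem init_momenta (hX : IsNormalFrame X b) (η : ℝ) (h : Hor n) :
    momenta X (startPoint η h) = η • h := by
  ext k
  simp [momenta, startPoint, hX.apply_zero, horCov_apply, dx, Pi.single_apply]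

/-- First pass: the term `J¹(x) P` is already `O(η²)`, so only the constant matrix `J̄` acts at
leading order. -/
theorem isBigO_momenta_sub (hX : IsNormalFrame X b) (hu : IsSolutionFamily X B T u) :
    (fun p => momenta X (u p) - p.1 • hHat b p.2.2 p.2.1) =O[unif B T] (fun p => p.1 ^ 2) := by
  refine isBigO_unif_of_deriv (f' := fun p => (fun k => ∑ l, momenta X (u p) l *
      (u p).2 (VectorField.lieBracket ℝ (X l) (X k) (u p).1)) -
        p.1 • (Jbar b *ᵥ hHat b p.2.2 p.2.1)) (JbarL b) ?_ ?_ ?_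
  · filter_upwards [hu.init] with η hη h hh
    simp [hη h hh, init_momenta hX, hHat_zero]
  · filter_upwards [hu.hasDerivWithinAt_momenta hX] with η hη h hh τ hτ
    exact (hη h hh τ hτ).sub ((hasDerivAt_hHat b τ h).const_smul η).hasDerivWithinAt
  · have h1 := isBigO_unif_mono (hu.isBigO_momenta_deriv hX) (show 2 ≤ 3 by norm_num)
    have h2 := isBigO_unif_mulVec (isBigO_unif_frameJ1 X hu.isBigO_base.prod_left_fst)
      (hu.isBigO_momenta hX) rfl
    refine (h1.add h2).congr_left fun p => ?_
    rw [JbarL_apply, Matrix.mulVec_sub, Matrix.mulVec_smul]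
    abel

theorem isBigO_hor_deriv (hX : IsNormalFrame X b) (hu : IsSolutionFamily X B T u) :
    (fun p => (∑ k, momenta X (u p) k • (X k (u p).1).1) - momenta X (u p)) =O[unif B T]
      (fun p => p.1 ^ 3) := by
  have h : (fun p => ∑ k, momenta X (u p) k • ((X k (u p).1).1 - Pi.single k 1)) =O[unif B T]
      (fun p => p.1 ^ 3) :=
    IsBigO.fun_sum fun k _ => isBigO_unif_smul (isBigO_pi.1 (hu.isBigO_momenta hX) k)
      (hu.isBigO_hor hX k) rfl
  refine h.congr_left fun p => ?_
  simp only [smul_sub, Finset.sum_sub_distrib]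
  congr 1
  ext j
  simp [Finset.sum_apply, Pi.single_apply]

theorem isBigO_hor_sub (hX : IsNormalFrame X b) (hb : ∀ i, b i ≠ 0)
    (hu : IsSolutionFamily X B T u) :
    (fun p => (u p).1.1 - p.1 • xHat b p.2.2 p.2.1) =O[unif B T] (fun p => p.1 ^ 2) := by
  refine isBigO_unif_of_deriv_zero (f' := fun p =>
    (∑ k, momenta X (u p) k • (X k (u p).1).1) - p.1 • hHat b p.2.2 p.2.1) ?_ ?_ ?_
  · filter_upwards [hu.init] with η hη h hh
    simp [hη h hh, startPoint, xHat_zero]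
  · filter_upwards [hu.hasDerivWithinAt_hor] with η hη h hh τ hτ
    exact (hη h hh τ hτ).sub ((hasDerivAt_xHat hb τ h).const_smul η).hasDerivWithinAt
  · have h1 := isBigO_unif_mono (hu.isBigO_hor_deriv hX) (show 2 ≤ 3 by norm_num)
    refine (h1.add (hu.isBigO_momenta_sub hX)).congr_left fun p => ?_
    abel

/-- Read off from the two bounds on the momenta, so no direct estimate of `ĥ` over `B` is required.
-/
theorem isBigO_smul_hHat (hX : IsNormalFrame X b) (hu : IsSolutionFamily X B T u) :
    (fun p => p.1 • hHat b p.2.2 p.2.1) =O[unif B T] (fun p => p.1 ^ 1) := by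
  simpa using (hu.isBigO_momenta hX).sub
    (isBigO_unif_mono (hu.isBigO_momenta_sub hX) one_le_two)

/-- The expansion of the momenta. -/
theorem isBigO_momenta_expansion (hX : IsNormalFrame X b) (hb : ∀ i, b i ≠ 0)
    (hu : IsSolutionFamily X B T u) :
    (fun p => momenta X (u p) -
      (p.1 • hHat b p.2.2 p.2.1 + p.1 ^ 2 • frameH1 X b p.2.2 p.2.1)) =O[unif B T]
      (fun p => p.1 ^ 3) := by
  refine isBigO_unif_of_deriv (f' := fun p => (fun k => ∑ l, momenta X (u p) l *
      (u p).2 (VectorField.lieBracket ℝ (X l) (X k) (u p).1)) -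
        (p.1 • (Jbar b *ᵥ hHat b p.2.2 p.2.1) + p.1 ^ 2 • (Jbar b *ᵥ frameH1 X b p.2.2 p.2.1 +
          frameJ1 X (xHat b p.2.2 p.2.1) *ᵥ hHat b p.2.2 p.2.1))) (JbarL b) ?_ ?_ ?_
  · filter_upwards [hu.init] with η hη h hh
    simp [hη h hh, init_momenta hX, hHat_zero, frameH1]
  · filter_upwards [hu.hasDerivWithinAt_momenta hX] with η hη h hh τ hτ
    exact (hη h hh τ hτ).sub (((hasDerivAt_hHat b τ h).const_smul η).add
      ((hasDerivAt_frameH1 hb τ h).const_smul (η ^ 2))).hasDerivWithinAt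
  · have h1 := hu.isBigO_momenta_deriv hX
    -- Splits `J¹(x) P - η² J¹(x̂) ĥ` as `J¹(x) (P - ηĥ) + J¹(x - ηx̂) (ηĥ)`, of orders `1 + 2` and
    -- `2 + 1`.
    have h2 := isBigO_unif_mulVec (k := 3) (isBigO_unif_frameJ1 X hu.isBigO_base.prod_left_fst)
      (hu.isBigO_momenta_sub hX) rfl
    have h3 := isBigO_unif_mulVec (k := 3) (isBigO_unif_frameJ1 X (hu.isBigO_hor_sub hX hb))
      (hu.isBigO_smul_hHat hX) rfl
    refine ((h1.add h2).add h3).congr_left fun p => ?_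
    have e : frameJ1 X ((u p).1.1 - p.1 • xHat b p.2.2 p.2.1) =
        frameJ1 X (u p).1.1 - p.1 • frameJ1 X (xHat b p.2.2 p.2.1) := by
      ext i l
      rw [frameJ1_sub_smul]
      rfl
    rw [e, JbarL_apply]
    simp only [Matrix.mulVec_sub, Matrix.mulVec_add, Matrix.mulVec_smul, Matrix.sub_mulVec,
      Matrix.smul_mulVec]
    module

/-- The expansion of `x`. -/
theorem isBigO_hor_expansion (hX : IsNormalFrame X b) (hb : ∀ i, b i ≠ 0)
    (hu : IsSolutionFamily X B T u) :
    (fun p => (u p).1.1 - (p.1 • xHat b p.2.2 p.2.1 +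
      p.1 ^ 2 • ∫ σ in (0 : ℝ)..p.2.2, frameH1 X b σ p.2.1)) =O[unif B T] (fun p => p.1 ^ 3) := by
  refine isBigO_unif_of_deriv_zero (f' := fun p =>
    (∑ k, momenta X (u p) k • (X k (u p).1).1) -
      (p.1 • hHat b p.2.2 p.2.1 + p.1 ^ 2 • frameH1 X b p.2.2 p.2.1)) ?_ ?_ ?_
  · filter_upwards [hu.init] with η hη h hh
    simp [hη h hh, startPoint, xHat_zero]
  · filter_upwards [hu.hasDerivWithinAt_hor] with η hη h hh τ hτ
    have hc : Continuous fun σ => frameH1 X b σ h := continuous_iff_continuousAt.2 fun t =>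
      (hasDerivAt_frameH1 hb t h).continuousAt
    exact (hη h hh τ hτ).sub (((hasDerivAt_xHat hb τ h).const_smul η).add
      ((hc.integral_hasStrictDerivAt 0 τ).hasDerivAt.const_smul (η ^ 2))).hasDerivWithinAt
  · refine ((hu.isBigO_hor_deriv hX).add (hu.isBigO_momenta_expansion hX hb)).congr_left
      fun p => ?_
    abel

/-- The expansion of `z`. -/
theorem isBigO_vert_expansion (hX : IsNormalFrame X b) (hb : ∀ i, b i ≠ 0)
    (hu : IsSolutionFamily X B T u) :
    (fun p => (u p).1.2 - p.1 ^ 2 * zHat b p.2.2 p.2.1) =O[unif B T] (fun p => p.1 ^ 3) := by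
  refine isBigO_unif_of_deriv_zero (f' := fun p =>
    (∑ k, momenta X (u p) k * (X k (u p).1).2) -
      p.1 ^ 2 * ∑ k, hHat b p.2.2 p.2.1 k * ((1 / 2) * (Jbar b *ᵥ xHat b p.2.2 p.2.1) k))
    ?_ ?_ ?_
  · filter_upwards [hu.init] with η hη h hh
    simp [hη h hh, startPoint, zHat_zero]
  · filter_upwards [hu.hasDerivWithinAt_vert] with η hη h hh τ hτ
    exact (hη h hh τ hτ).sub ((hasDerivAt_zHat hb τ h).const_mul (η ^ 2)).hasDerivWithinAt
  · have h1 : (fun p => ∑ k, momenta X (u p) k *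
        ((X k (u p).1).2 - (1 / 2) * (Jbar b *ᵥ (u p).1.1) k)) =O[unif B T] (fun p => p.1 ^ 3) :=
      IsBigO.fun_sum fun k _ => isBigO_unif_mul (isBigO_pi.1 (hu.isBigO_momenta hX) k)
        (hu.isBigO_vert hX k) rfl
    have h2 : (fun p => ∑ k, (momenta X (u p) - p.1 • hHat b p.2.2 p.2.1) k *
        ((1 / 2) * (Jbar b *ᵥ (u p).1.1) k)) =O[unif B T] (fun p => p.1 ^ 3) :=
      IsBigO.fun_sum fun k _ => isBigO_unif_mul (isBigO_pi.1 (hu.isBigO_momenta_sub hX) k)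
        (isBigO_unif_mul (isBigO_unif_const _)
          (isBigO_pi.1 (hu.isBigO_mulVec_hor (Jbar b)) k) (zero_add 1)) rfl
    have h3 : (fun p => ∑ k, (p.1 • hHat b p.2.2 p.2.1) k *
        ((1 / 2) * (Jbar b *ᵥ ((u p).1.1 - p.1 • xHat b p.2.2 p.2.1)) k)) =O[unif B T]
        (fun p => p.1 ^ 3) :=
      IsBigO.fun_sum fun k _ => isBigO_unif_mul (isBigO_pi.1 (hu.isBigO_smul_hHat hX) k)
        (isBigO_unif_mul (isBigO_unif_const _)
          (isBigO_pi.1 (isBigO_unif_mulVec (A := fun _ => Jbar b) (fun _ _ => isBigO_unif_const _)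
            (hu.isBigO_hor_sub hX hb) (zero_add 2)) k) (zero_add 2)) rfl
    refine ((h1.add h2).add h3).congr_left fun p => ?_
    simp only [← Finset.sum_add_distrib, Finset.mul_sum, ← Finset.sum_sub_distrib,
      Matrix.mulVec_sub, Matrix.mulVec_smul, Pi.sub_apply, Pi.smul_apply, smul_eq_mul]
    exact Finset.sum_congr rfl fun k _ => by ring

end IsSolutionFamily

end Expansion

/-! ### Existence of the rescaled solutions -/

section Existence

variable {n : ℕ} {X : HIdx n → Coord n → Coord n} {b : Fin n → ℝ}

theorem norm_horCov_le_of_mem_ballB {R : ℝ} {h : Hor n} (hh : h ∈ ballB n R) :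
    ‖horCov h‖ ≤ ∑ _k : HIdx n, √R := by
  refine ContinuousLinearMap.opNorm_le_bound _ (Finset.sum_nonneg fun _ _ => Real.sqrt_nonneg _)
    fun y => ?_
  rw [horCov_apply, Finset.sum_mul]
  refine norm_sum_le_of_le _ fun k _ => ?_
  rw [norm_mul]
  have h1 : ‖h k‖ ≤ √R := by
    refine Real.abs_le_sqrt (le_trans ?_ hh)
    exact Finset.single_le_sum (f := fun k => h k ^ 2) (fun _ _ => sq_nonneg _)
      (Finset.mem_univ k)
  have h2 : ‖y.1 k‖ ≤ ‖y‖ := (norm_le_pi_norm y.1 k).trans (norm_fst_le y)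
  gcongr

/-- The truncated field `G` has solutions on all of `[0, T]`. They converge uniformly to the
equilibrium, near which `G` equals `hamField X`, so for small `η` they solve the original equation.
-/
theorem exists_solutionFamily (hX : IsNormalFrame X b) {B : Set (Hor n)} {C : ℝ}
    (hB : ∀ h ∈ B, ‖horCov h‖ ≤ C) {T : ℝ} (hT : 0 ≤ T) :
    ∃ u, IsSolutionFamily X B T u := by
  obtain ⟨G, K, L, hGK, hGL, hGF⟩ := exists_lipschitz_bounded_germ
    (contDiffAt_hamField (u := restPoint n) hX.contDiffAt)
  choose sol hsol0 hsol using fun v => exists_solution_of_lipschitz_of_bounded hGK hGL v hT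
  have hGe : G (restPoint n) = 0 := by rw [hGF.self_of_nhds, hamField_restPoint hX]
  have hnear : (fun p : ℝ × Hor n × ℝ => sol (startPoint p.1 p.2.1) p.2.2 - restPoint n)
      =O[unif B T] (fun p => p.1 ^ 1) := by
    rw [isBigO_unif]
    refine ⟨C * Real.exp (K * T), ?_⟩
    filter_upwards [self_mem_nhdsWithin] with η hη h hh τ hτ
    refine (norm_sub_le_of_solution hGK hGe (hsol (startPoint η h)) hτ).trans ?_
    have h1 : ‖sol (startPoint η h) 0 - restPoint n‖ ≤ η * C := by
      rw [hsol0]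
      simp only [startPoint, restPoint, Prod.mk_sub_mk, sub_self, add_sub_cancel_left,
        Prod.norm_mk, norm_zero, norm_smul, Real.norm_of_nonneg (le_of_lt hη)]
      rw [max_eq_right (mul_nonneg (le_of_lt hη) (norm_nonneg _))]
      exact mul_le_mul_of_nonneg_left (hB h hh) (le_of_lt hη)
    calc _ ≤ η * C * Real.exp (K * T) := by gcongr
      _ = _ := by ring
  refine ⟨fun p => sol (startPoint p.1 p.2.1) p.2.2, ?_, ?_, hnear⟩
  · exact Eventually.of_forall fun η h _ => hsol0 _
  · have hlim : Tendsto (fun p : ℝ × Hor n × ℝ => sol (startPoint p.1 p.2.1) p.2.2)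
        (unif B T) (𝓝 (restPoint n)) := by
      have h1 := hnear.trans_tendsto
        (by simpa using (tendsto_unif_fst (B := B) (T := T)).pow 1)
      simpa using h1.add_const (restPoint n)
    filter_upwards [eventually_unif.1 (hlim.eventually hGF)] with η hη h hh τ hτ
    have := hsol (startPoint η h) τ hτ
    rwa [hη h hh τ hτ] at this

end Existence

/-! ### Charts -/

theorem eventually_mem_target_and_mem_source {E M : Type*} [TopologicalSpace E]
    [TopologicalSpace M] {φ ψ : OpenPartialHomeomorph M E} {q : M} (hq : q ∈ φ.source) (hq' : q ∈ ψ.source) :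
    ∀ᶠ y in 𝓝 (ψ q), y ∈ ψ.target ∧ ψ.symm y ∈ φ.source := by
  have h1 := ψ.open_target.mem_nhds (ψ.map_source hq')
  have h2 : ContinuousAt ψ.symm (ψ q) := ψ.continuousAt_symm (ψ.map_source hq')
  have h3 := h2.preimage_mem_nhds (φ.open_source.mem_nhds (by rwa [ψ.left_inv hq']))
  filter_upwards [h1, h3] with y h4 h5 using ⟨h4, h5⟩

section Charts

variable {n : ℕ} {M : Type*} [TopologicalSpace M] [ChartedSpace (Coord n) M]
  {φ ψ : OpenPartialHomeomorph M (Coord n)}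

theorem mdifferentiable_of_mem_maximalAtlas
    (hφ : φ ∈ IsManifold.maximalAtlas 𝓘(ℝ, Coord n) ∞ M) :
    φ.MDifferentiable 𝓘(ℝ, Coord n) 𝓘(ℝ, Coord n) :=
  ⟨(contMDiffOn_of_mem_maximalAtlas hφ).mdifferentiableOn (by simp),
    (contMDiffOn_symm_of_mem_maximalAtlas hφ).mdifferentiableOn (by simp)⟩

theorem exists_chartDeriv_equiv (hφ : φ ∈ IsManifold.maximalAtlas 𝓘(ℝ, Coord n) ∞ M) {q : M}
    (hq : q ∈ φ.source) :
    ∃ e : TangentSpace 𝓘(ℝ, Coord n) q ≃L[ℝ] Coord n,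
      (e : TangentSpace 𝓘(ℝ, Coord n) q →L[ℝ] Coord n) = chartDeriv φ q :=
  ⟨(mdifferentiable_of_mem_maximalAtlas hφ).mfderiv hq, rfl⟩

theorem inverse_chartDeriv_apply (hφ : φ ∈ IsManifold.maximalAtlas 𝓘(ℝ, Coord n) ∞ M) {q : M}
    (hq : q ∈ φ.source) (v : TangentSpace 𝓘(ℝ, Coord n) q) :
    (chartDeriv φ q).inverse (chartDeriv φ q v) = v := by
  obtain ⟨e, he⟩ := exists_chartDeriv_equiv hφ hq
  rw [← he, ContinuousLinearMap.inverse_equiv]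
  simp

theorem chartDeriv_inverse_apply (hφ : φ ∈ IsManifold.maximalAtlas 𝓘(ℝ, Coord n) ∞ M) {q : M}
    (hq : q ∈ φ.source) (v : Coord n) :
    chartDeriv φ q ((chartDeriv φ q).inverse v) = v := by
  obtain ⟨e, he⟩ := exists_chartDeriv_equiv hφ hq
  rw [← he, ContinuousLinearMap.inverse_equiv]
  simp

theorem contDiffAt_transition [IsManifold 𝓘(ℝ, Coord n) ∞ M]
    (hφ : φ ∈ IsManifold.maximalAtlas 𝓘(ℝ, Coord n) ∞ M)
    (hψ : ψ ∈ IsManifold.maximalAtlas 𝓘(ℝ, Coord n) ∞ M) {q : M} (hq : q ∈ φ.source)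
    (hq' : q ∈ ψ.source) : ContDiffAt ℝ ∞ (ψ ∘ φ.symm) (φ q) := by
  have h1 : ContMDiffAt 𝓘(ℝ, Coord n) 𝓘(ℝ, Coord n) ∞ φ.symm (φ q) :=
    (contMDiffOn_symm_of_mem_maximalAtlas hφ).contMDiffAt
      (φ.open_target.mem_nhds (φ.map_source hq))
  have h2 : ContMDiffAt 𝓘(ℝ, Coord n) 𝓘(ℝ, Coord n) ∞ ψ (φ.symm (φ q)) := by
    rw [φ.left_inv hq]
    exact (contMDiffOn_of_mem_maximalAtlas hψ).contMDiffAt (ψ.open_source.mem_nhds hq')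
  exact contMDiffAt_iff_contDiffAt.1 (h2.comp (φ q) h1)

theorem chartDeriv_eq_fderiv_transition [IsManifold 𝓘(ℝ, Coord n) ∞ M]
    (hφ : φ ∈ IsManifold.maximalAtlas 𝓘(ℝ, Coord n) ∞ M)
    (hψ : ψ ∈ IsManifold.maximalAtlas 𝓘(ℝ, Coord n) ∞ M) {q : M} (hq : q ∈ φ.source)
    (hq' : q ∈ ψ.source) (v : TangentSpace 𝓘(ℝ, Coord n) q) :
    chartDeriv ψ q v = fderiv ℝ (ψ ∘ φ.symm) (φ q) (chartDeriv φ q v) := by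
  have h1 := ((contDiffAt_transition hφ hψ hq hq').differentiableAt (by simp)).hasFDerivAt
  have h2 := ((mdifferentiable_of_mem_maximalAtlas hφ).mdifferentiableAt hq).hasMFDerivAt
  have h3 := HasMFDerivAt.comp q h1.hasMFDerivAt h2
  have h4 : (ψ ∘ φ.symm) ∘ φ =ᶠ[𝓝 q] ψ := by
    filter_upwards [φ.open_source.mem_nhds hq] with x hx
    simp [φ.left_inv hx]
  have h5 := (h3.congr_of_eventuallyEq h4.symm).mfderiv
  rw [chartDeriv, h5]
  rfl

theorem covInChart_chartDeriv (hφ : φ ∈ IsManifold.maximalAtlas 𝓘(ℝ, Coord n) ∞ M)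
    {c : CotBundle n M} (hq : c.1 ∈ φ.source) (v : TangentSpace 𝓘(ℝ, Coord n) c.1) :
    covInChart φ c (chartDeriv φ c.1 v) = c.2 v := by
  simp [covInChart, inverse_chartDeriv_apply hφ hq]

theorem covInChart_transition [IsManifold 𝓘(ℝ, Coord n) ∞ M]
    (hφ : φ ∈ IsManifold.maximalAtlas 𝓘(ℝ, Coord n) ∞ M)
    (hψ : ψ ∈ IsManifold.maximalAtlas 𝓘(ℝ, Coord n) ∞ M) {c : CotBundle n M}
    (hq : c.1 ∈ φ.source) (hq' : c.1 ∈ ψ.source) :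
    covInChart ψ c = (covInChart φ c).comp (fderiv ℝ (φ ∘ ψ.symm) (ψ c.1)) := by
  refine ContinuousLinearMap.ext fun v => ?_
  obtain ⟨w, rfl⟩ : ∃ w, chartDeriv ψ c.1 w = v := ⟨_, chartDeriv_inverse_apply hψ hq' v⟩
  rw [ContinuousLinearMap.comp_apply, covInChart_chartDeriv hψ hq',
    ← chartDeriv_eq_fderiv_transition hψ hφ hq' hq, covInChart_chartDeriv hφ hq]

theorem fieldInChart_transition [IsManifold 𝓘(ℝ, Coord n) ∞ M]
    (hφ : φ ∈ IsManifold.maximalAtlas 𝓘(ℝ, Coord n) ∞ M)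
    (hψ : ψ ∈ IsManifold.maximalAtlas 𝓘(ℝ, Coord n) ∞ M)
    (Y : (q : M) → TangentSpace 𝓘(ℝ, Coord n) q) {y : Coord n} (hy : y ∈ ψ.target)
    (hy' : ψ.symm y ∈ φ.source) :
    fieldInChart φ Y (φ (ψ.symm y)) =
      fderiv ℝ (φ ∘ ψ.symm) y (fieldInChart ψ Y y) := by
  rw [fieldInChart, φ.left_inv hy',
    chartDeriv_eq_fderiv_transition hψ hφ (ψ.map_target hy) hy', ψ.right_inv hy]
  rfl

theorem contDiffAt_fieldInChart [IsManifold 𝓘(ℝ, Coord n) ∞ M]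
    (hφ : φ ∈ IsManifold.maximalAtlas 𝓘(ℝ, Coord n) ∞ M)
    (hψ : ψ ∈ IsManifold.maximalAtlas 𝓘(ℝ, Coord n) ∞ M)
    {Y : (q : M) → TangentSpace 𝓘(ℝ, Coord n) q}
    (hY : ContDiffOn ℝ ∞ (fieldInChart φ Y) φ.target) {q : M} (hq : q ∈ φ.source)
    (hq' : q ∈ ψ.source) : ContDiffAt ℝ ∞ (fieldInChart ψ Y) (ψ q) := by
  have hev : fieldInChart ψ Y =ᶠ[𝓝 (ψ q)] fun y =>
      fderiv ℝ (ψ ∘ φ.symm) ((φ ∘ ψ.symm) y) (fieldInChart φ Y ((φ ∘ ψ.symm) y)) := by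
    filter_upwards [eventually_mem_target_and_mem_source hq hq'] with y hy
    have h := fieldInChart_transition hψ hφ Y (φ.map_source hy.2)
      (by rw [φ.left_inv hy.2]; exact ψ.map_target hy.1)
    rwa [φ.left_inv hy.2, ψ.right_inv hy.1] at h
  have h1 := contDiffAt_transition hψ hφ hq' hq
  have e : (φ ∘ ψ.symm) (ψ q) = φ q := by simp [ψ.left_inv hq']
  have h2 : ContDiffAt ℝ ∞ (fderiv ℝ (ψ ∘ φ.symm)) ((φ ∘ ψ.symm) (ψ q)) := by
    rw [e]
    exact (contDiffAt_transition hφ hψ hq hq').fderiv_right (by simp)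
  have h3 : ContDiffAt ℝ ∞ (fieldInChart φ Y) ((φ ∘ ψ.symm) (ψ q)) := by
    rw [e]
    exact hY.contDiffAt (φ.open_target.mem_nhds (φ.map_source hq))
  exact ((h2.comp _ h1).clm_apply (h3.comp _ h1)).congr_of_eventuallyEq hev

end Charts

/-! ### The Hamiltonian in a frame -/

section Hamiltonian

variable {n : ℕ} {M : Type*} [TopologicalSpace M] [ChartedSpace (Coord n) M]
  {S : ContactSubRiemannian n M} {q₀ : M}

/-- The coordinates of a covector, given by a chart. -/
noncomputable def chartCov (ψ : OpenPartialHomeomorph M (Coord n)) (c : CotBundle n M) :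
    Coord n × (Coord n →L[ℝ] ℝ) :=
  (ψ c.1, covInChart ψ c)

namespace AGNormalForm

/-- The contact form is nonzero, since it is `1` on `∂_z`, so rank–nullity applies to its kernel. -/
theorem finrank_distribution (N : AGNormalForm S q₀) {q : M} (hq : q ∈ N.φ.source) :
    Module.finrank ℝ (S.Δ q) = Fintype.card (HIdx n) := by
  obtain ⟨e, he⟩ := exists_chartDeriv_equiv N.φ_mem hq
  have hfin : Module.Finite ℝ (TangentSpace 𝓘(ℝ, Coord n) q) :=
    Module.Finite.equiv e.symm.toLinearEquiv
  let f : TangentSpace 𝓘(ℝ, Coord n) q →ₗ[ℝ] ℝ :=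
    ((N.θ (N.φ q)).comp (chartDeriv N.φ q)).toLinearMap
  have hker : S.Δ q = LinearMap.ker f := by
    ext v
    exact N.θ_ker q hq v
  have hrange : LinearMap.range f = ⊤ := by
    refine LinearMap.range_eq_top.2 fun r => ?_
    refine ⟨r • (chartDeriv N.φ q).inverse (dz n), ?_⟩
    change N.θ (N.φ q) (chartDeriv N.φ q (r • (chartDeriv N.φ q).inverse (dz n))) = r
    rw [map_smul, chartDeriv_inverse_apply N.φ_mem hq, map_smul,
      N.θ_reeb _ (N.φ.map_source hq), smul_eq_mul, mul_one]
  have h1 := LinearMap.finrank_range_add_finrank_ker f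
  rw [hrange, finrank_top, Module.finrank_self, ← hker, e.toLinearEquiv.finrank_eq] at h1
  have h2 : Module.finrank ℝ (Coord n) = Fintype.card (HIdx n) + 1 := by
    simp [Module.finrank_prod]
  omega

theorem exists_basis (N : AGNormalForm S q₀) {q : M} (hq : q ∈ N.φ.source) :
    ∃ B : Module.Basis (HIdx n) ℝ (S.Δ q), ∀ k, B k = N.X k q := by
  have hfr := N.finrank_distribution hq
  have hli : LinearIndependent ℝ fun k => N.X k q := by
    rw [Fintype.linearIndependent_iff]
    intro a ha k
    have h := congrArg (fun v => S.g q v (N.X k q)) ha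
    simpa [map_sum, LinearMap.sum_apply, N.X_orthonormal q hq] using h
  -- `basisOfLinearIndependentOfCardEqFinrank` requires a nonempty index type, so the
  -- zero-dimensional distribution is handled by the empty basis.
  by_cases hn : Nonempty (HIdx n)
  · exact ⟨basisOfLinearIndependentOfCardEqFinrank hli hfr.symm, fun k => by simp⟩
  · have : IsEmpty (HIdx n) := not_nonempty_iff.1 hn
    obtain ⟨e, he⟩ := exists_chartDeriv_equiv N.φ_mem hq
    have hfin : Module.Finite ℝ (TangentSpace 𝓘(ℝ, Coord n) q) :=
      Module.Finite.equiv e.symm.toLinearEquiv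
    have : Subsingleton (S.Δ q) := Module.finrank_zero_iff.1 (hfr.trans Fintype.card_eq_zero)
    exact ⟨Module.Basis.empty _, fun k => isEmptyElim k⟩

/-- Cauchy–Schwarz in the orthonormal frame, with equality at `v = ∑ ⟨p, X_k⟩ X_k`. -/
theorem ham_eq (N : AGNormalForm S q₀) (c : CotBundle n M) (hq : c.1 ∈ N.φ.source) :
    S.ham c = (1 / 2) * ∑ k, (c.2 (N.X k c.1)) ^ 2 := by
  obtain ⟨B, hB⟩ := N.exists_basis hq
  rw [ContactSubRiemannian.ham]
  congr 1
  have hp : ∀ a : HIdx n → ℝ, c.2 ((∑ k, a k • N.X k c.1 : S.Δ c.1) :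
      TangentSpace 𝓘(ℝ, Coord n) c.1) = ∑ k, a k * c.2 (N.X k c.1) := by
    intro a
    simp [map_sum]
  have hg : ∀ a : HIdx n → ℝ,
      S.g c.1 (∑ k, a k • N.X k c.1) (∑ k, a k • N.X k c.1) = ∑ k, a k ^ 2 := by
    intro a
    simp [map_sum, LinearMap.sum_apply, N.X_orthonormal c.1 hq, sq]
  have hexp : ∀ v : S.Δ c.1, v = ∑ k, B.repr v k • N.X k c.1 := by
    intro v
    conv_lhs => rw [← B.sum_repr v]
    simp only [hB]
  refine le_antisymm ?_ ?_
  · refine Real.sSup_le ?_ (Finset.sum_nonneg fun _ _ => sq_nonneg _)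
    rintro r ⟨v, hv, rfl⟩
    rw [div_le_iff₀ (S.g_pos _ _ hv)]
    rw [hexp v, hp, hg, mul_comm]
    exact Finset.sum_mul_sq_le_sq_mul_sq _ _ _
  -- If all momenta vanish, the maximizer is the excluded vector `0`, and nonnegativity of the
  -- supremum is enough.
  · by_cases h0 : ∑ k, (c.2 (N.X k c.1)) ^ 2 = 0
    · rw [h0]
      refine Real.sSup_nonneg ?_
      rintro r ⟨v, hv, rfl⟩
      exact div_nonneg (sq_nonneg _) (S.g_pos _ _ hv).le
    · refine le_csSup ⟨∑ k, (c.2 (N.X k c.1)) ^ 2, ?_⟩ ?_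
      · rintro r ⟨v, hv, rfl⟩
        rw [div_le_iff₀ (S.g_pos _ _ hv)]
        rw [hexp v, hp, hg, mul_comm]
        exact Finset.sum_mul_sq_le_sq_mul_sq _ _ _
      · refine ⟨∑ k, c.2 (N.X k c.1) • N.X k c.1, ?_, ?_⟩
        · intro hv
          have := hg fun k => c.2 (N.X k c.1)
          rw [hv] at this
          exact h0 (by simpa using this.symm)
        · rw [hp, hg]
          simp only [← sq]
          field_simp

/-- The frame in an arbitrary chart. -/
noncomputable def frameIn (N : AGNormalForm S q₀) (ψ : OpenPartialHomeomorph M (Coord n)) (k : HIdx n) :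
    Coord n → Coord n :=
  fieldInChart ψ fun q => (N.X k q : TangentSpace 𝓘(ℝ, Coord n) q)

theorem hamInChart_eq (N : AGNormalForm S q₀) {ψ : OpenPartialHomeomorph M (Coord n)}
    {y : Coord n} (hy : ψ.symm y ∈ N.φ.source) (ξ : Coord n →L[ℝ] ℝ) :
    S.hamInChart ψ y ξ = (1 / 2) * ∑ k, (ξ (N.frameIn ψ k y)) ^ 2 :=
  N.ham_eq ⟨ψ.symm y, ξ.comp (chartDeriv ψ (ψ.symm y))⟩ hy

theorem fderiv_hamInChart_cov (N : AGNormalForm S q₀) {ψ : OpenPartialHomeomorph M (Coord n)}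
    {q : M} (hq : q ∈ N.φ.source) (hq' : q ∈ ψ.source) (ξ ζ : Coord n →L[ℝ] ℝ) :
    fderiv ℝ (fun ξ => S.hamInChart ψ (ψ q) ξ) ξ ζ = ζ (hamField (N.frameIn ψ) (ψ q, ξ)).1 := by
  have h : (fun ξ => S.hamInChart ψ (ψ q) ξ) =
      fun ξ => (1 / 2) * ∑ k, (ξ (N.frameIn ψ k (ψ q))) ^ 2 :=
    funext fun ξ => N.hamInChart_eq (by rwa [ψ.left_inv hq']) ξ
  have hd : ∀ k, HasFDerivAt (fun ξ : Coord n →L[ℝ] ℝ => (ξ (N.frameIn ψ k (ψ q))) ^ 2) _ ξ :=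
    fun k => ((hasFDerivAt_id ξ).clm_apply (hasFDerivAt_const (N.frameIn ψ k (ψ q)) ξ)).pow 2
  rw [h, ((HasFDerivAt.fun_sum fun k _ => hd k).const_mul (1 / 2)).fderiv]
  simp only [hamField, map_sum, map_smul, smul_apply, sum_apply, add_apply,
    ContinuousLinearMap.comp_apply, ContinuousLinearMap.flip_apply, smul_eq_mul, Finset.mul_sum,
    zero_apply, map_zero, id_eq, ContinuousLinearMap.id_apply]
  refine Finset.sum_congr rfl fun k _ => ?_
  simp
  ring

variable [IsManifold 𝓘(ℝ, Coord n) ∞ M]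

theorem contDiffAt_frameIn (N : AGNormalForm S q₀) {ψ : OpenPartialHomeomorph M (Coord n)}
    (hψ : ψ ∈ IsManifold.maximalAtlas 𝓘(ℝ, Coord n) ∞ M) {q : M} (hq : q ∈ N.φ.source)
    (hq' : q ∈ ψ.source) (k : HIdx n) : ContDiffAt ℝ ∞ (N.frameIn ψ k) (ψ q) :=
  contDiffAt_fieldInChart N.φ_mem hψ (N.X_smooth k) hq hq'

theorem fderiv_hamInChart_base (N : AGNormalForm S q₀) {ψ : OpenPartialHomeomorph M (Coord n)}
    (hψ : ψ ∈ IsManifold.maximalAtlas 𝓘(ℝ, Coord n) ∞ M)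
    {q : M} (hq : q ∈ N.φ.source) (hq' : q ∈ ψ.source) (ξ : Coord n →L[ℝ] ℝ) :
    -fderiv ℝ (fun y => S.hamInChart ψ y ξ) (ψ q) = (hamField (N.frameIn ψ) (ψ q, ξ)).2 := by
  have h : (fun y => S.hamInChart ψ y ξ) =ᶠ[𝓝 (ψ q)]
      fun y => (1 / 2) * ∑ k, (ξ (N.frameIn ψ k y)) ^ 2 := by
    filter_upwards [eventually_mem_target_and_mem_source hq hq'] with y hy
    exact N.hamInChart_eq hy.2 ξ
  have hd : ∀ k, HasFDerivAt (fun y => (ξ (N.frameIn ψ k y)) ^ 2) _ (ψ q) := fun k =>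
    (ξ.hasFDerivAt.comp (ψ q) ((N.contDiffAt_frameIn hψ hq hq' k).differentiableAt
      (by simp)).hasFDerivAt).pow 2
  rw [h.fderiv_eq, ((HasFDerivAt.fun_sum fun k _ => hd k).const_mul (1 / 2)).fderiv]
  simp only [hamField]
  congr 1
  rw [Finset.smul_sum]
  refine Finset.sum_congr rfl fun k _ => ?_
  refine ContinuousLinearMap.ext fun v => ?_
  simp
  ring

/-- Hamilton's equations in a chart. -/
theorem hamilton_iff (N : AGNormalForm S q₀) {ψ : OpenPartialHomeomorph M (Coord n)}
    (hψ : ψ ∈ IsManifold.maximalAtlas 𝓘(ℝ, Coord n) ∞ M) {c : ℝ → CotBundle n M} {s : Set ℝ}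
    {t : ℝ} (hq : (c t).1 ∈ N.φ.source) (hq' : (c t).1 ∈ ψ.source) :
    ((∃ v : Coord n, HasDerivWithinAt (fun u => ψ (c u).1) v s t ∧
      ∀ ζ : Coord n →L[ℝ] ℝ,
        ζ v = fderiv ℝ (fun ξ => S.hamInChart ψ (ψ (c t).1) ξ) (covInChart ψ (c t)) ζ) ∧
    HasDerivWithinAt (fun u => covInChart ψ (c u))
      (-(fderiv ℝ (fun y => S.hamInChart ψ y (covInChart ψ (c t))) (ψ (c t).1))) s t) ↔
    HasDerivWithinAt (fun u => chartCov ψ (c u)) (hamField (N.frameIn ψ) (chartCov ψ (c t)))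
      s t := by
  rw [N.fderiv_hamInChart_base hψ hq hq']
  simp only [N.fderiv_hamInChart_cov hq hq']
  constructor
  · rintro ⟨⟨v, hv, hζ⟩, hξ⟩
    -- Covectors separate vectors, so testing against every `ζ` determines the velocity.
    have : v = (hamField (N.frameIn ψ) (ψ (c t).1, covInChart ψ (c t))).1 :=
      (SeparatingDual.eq_iff_forall_dual_eq (R := ℝ)).2 hζ
    rw [this] at hv
    exact hv.prodMk hξ
  · intro h
    exact ⟨⟨_, by simpa [chartCov] using h.hasFDerivWithinAt.fst.hasDerivWithinAt,
      fun _ => rfl⟩, by simpa [chartCov] using h.hasFDerivWithinAt.snd.hasDerivWithinAt⟩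

end AGNormalForm

end Hamiltonian

/-! ### Normal extremals in charts -/

section Extremals

variable {n : ℕ}

theorem hasDerivWithinAt_prod_fst {E F : Type*} [NormedAddCommGroup E] [NormedSpace ℝ E]
    [NormedAddCommGroup F] [NormedSpace ℝ F] {w : ℝ → E × F} {w' : E × F} {s : Set ℝ} {t : ℝ}
    (h : HasDerivWithinAt w w' s t) : HasDerivWithinAt (fun r => (w r).1) w'.1 s t := by
  simpa using h.hasFDerivWithinAt.fst.hasDerivWithinAt

theorem hasDerivWithinAt_prod_snd {E F : Type*} [NormedAddCommGroup E] [NormedSpace ℝ E]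
    [NormedAddCommGroup F] [NormedSpace ℝ F] {w : ℝ → E × F} {w' : E × F} {s : Set ℝ} {t : ℝ}
    (h : HasDerivWithinAt w w' s t) : HasDerivWithinAt (fun r => (w r).2) w'.2 s t := by
  simpa using h.hasFDerivWithinAt.snd.hasDerivWithinAt

/-- Invariance of Hamilton's equations for the covector under a change `κ` of coordinates. -/
theorem hasDerivWithinAt_cov_of_change {X Y : HIdx n → Coord n → Coord n}
    {κ : Coord n → Coord n} {v w : ℝ → Coord n × (Coord n →L[ℝ] ℝ)} {s : Set ℝ} {t : ℝ}
    (ht : t ∈ s) (hκ : ContDiffAt ℝ 2 κ (w t).1)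
    (hX : ∀ k, DifferentiableAt ℝ (X k) (κ (w t).1))
    (hY : ∀ k, DifferentiableAt ℝ (Y k) (w t).1)
    (hXY : ∀ k, ∀ᶠ y in 𝓝 (w t).1, X k (κ y) = fderiv ℝ κ y (Y k y))
    (hv1 : (v t).1 = κ (w t).1)
    (hv2 : HasDerivWithinAt (fun r => (v r).2) (hamField X (v t)).2 s t)
    (hw1 : HasDerivWithinAt (fun r => (w r).1) (hamField Y (w t)).1 s t)
    (hw2 : ∀ᶠ r in 𝓝[s] t, (w r).2 = (v r).2.comp (fderiv ℝ κ (w r).1)) :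
    HasDerivWithinAt (fun r => (w r).2) (hamField Y (w t)).2 s t := by
  have hκ1 : HasFDerivAt κ (fderiv ℝ κ (w t).1) (w t).1 :=
    (hκ.differentiableAt two_ne_zero).hasFDerivAt
  have hκ2 : HasFDerivAt (fderiv ℝ κ) (fderiv ℝ (fderiv ℝ κ) (w t).1) (w t).1 :=
    ((hκ.fderiv_right (m := 1) (by norm_num)).differentiableAt one_ne_zero).hasFDerivAt
  have hsymm : IsSymmSndFDerivAt ℝ κ (w t).1 := hκ.isSymmSndFDerivAt (by simp)
  have hwt : (w t).2 = (v t).2.comp (fderiv ℝ κ (w t).1) := hw2.self_of_nhdsWithin ht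
  have hXYt : ∀ k, X k (κ (w t).1) = fderiv ℝ κ (w t).1 (Y k (w t).1) := fun k =>
    (hXY k).self_of_nhds
  -- Differentiating the relation `X ∘ κ = Dκ · Y` produces a second derivative of `κ`.
  have hD : ∀ k z, fderiv ℝ (X k) (κ (w t).1) (fderiv ℝ κ (w t).1 z) =
      fderiv ℝ (fderiv ℝ κ) (w t).1 z (Y k (w t).1) +
        fderiv ℝ κ (w t).1 (fderiv ℝ (Y k) (w t).1 z) := by
    intro k z
    have h1 := (hX k).hasFDerivAt.comp (w t).1 hκ1
    have h2 := (hκ2.clm_apply (hY k).hasFDerivAt).congr_of_eventuallyEq (hXY k)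
    have h3 := DFunLike.congr_fun (h1.unique h2) z
    simpa [add_comm] using h3
  have key := (hv2.clm_comp (hκ2.comp_hasDerivWithinAt t hw1)).congr_of_eventuallyEq hw2 hwt
  refine key.congr_deriv (ContinuousLinearMap.ext fun z => ?_)
  simp only [hamField, hv1, hwt, hXYt, add_apply, neg_apply, sum_apply, smul_apply,
    ContinuousLinearMap.comp_apply, map_sum, map_smul, Function.comp_apply, smul_eq_mul, hD,
    map_add, mul_add, Finset.sum_add_distrib]
  -- By symmetry of the second derivative, the term from differentiating `Dκ` along the curve
  -- cancels the one from `hD`.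
  have e : ∀ k, fderiv ℝ (fderiv ℝ κ) (w t).1 (Y k (w t).1) z =
      fderiv ℝ (fderiv ℝ κ) (w t).1 z (Y k (w t).1) := fun k => hsymm.eq _ _
  simp only [e]
  ring

/-- The base part of `hamField` has degree `1` and the covector part degree `2` in the covector, so
speeding up time by `η⁻¹` matches scaling covectors by `η⁻¹`. -/
theorem hasDerivWithinAt_rescale {X : HIdx n → Coord n → Coord n}
    {v : ℝ → Coord n × (Coord n →L[ℝ] ℝ)} {η T t : ℝ} (hη : 0 < η)
    (hv : HasDerivWithinAt v (hamField X (v (t / η))) (Icc 0 T) (t / η)) :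
    HasDerivWithinAt (fun r => ((v (r / η)).1, η⁻¹ • (v (r / η)).2))
      (hamField X ((v (t / η)).1, η⁻¹ • (v (t / η)).2)) (Icc 0 (η * T)) t := by
  have hdiv : HasDerivWithinAt (fun r : ℝ => r / η) η⁻¹ (Icc 0 (η * T)) t := by
    simpa using (hasDerivWithinAt_id t (Icc 0 (η * T))).div_const η
  have hmaps : MapsTo (fun r : ℝ => r / η) (Icc 0 (η * T)) (Icc 0 T) := fun r hr =>
    ⟨div_nonneg hr.1 hη.le, by rw [div_le_iff₀ hη, mul_comm]; exact hr.2⟩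
  have h := hv.scomp t hdiv hmaps
  have h1 : HasDerivWithinAt (fun r => (v (r / η)).1) _ (Icc 0 (η * T)) t :=
    hasDerivWithinAt_prod_fst h
  have h2 : HasDerivWithinAt (fun r => (v (r / η)).2) _ (Icc 0 (η * T)) t :=
    hasDerivWithinAt_prod_snd h
  refine (h1.prodMk (h2.const_smul η⁻¹)).congr_deriv ?_
  refine Prod.ext ?_ (ContinuousLinearMap.ext fun z => ?_)
  · simp [hamField, Finset.smul_sum, smul_smul]
  · simp only [hamField, Prod.smul_snd, smul_neg, neg_apply, smul_apply, sum_apply,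
      ContinuousLinearMap.comp_apply, smul_eq_mul, Finset.mul_sum]
    exact congrArg Neg.neg (Finset.sum_congr rfl fun k _ => by ring)

variable {M : Type*} [TopologicalSpace M] [ChartedSpace (Coord n) M]
  {S : ContactSubRiemannian n M} {q₀ : M}

namespace AGNormalForm

theorem isNormalFrame (N : AGNormalForm S q₀) : IsNormalFrame (N.frameIn N.φ) N.b := by
  have h0 : (0 : Coord n) ∈ N.φ.target := N.φ_center ▸ N.φ.map_source N.mem_source
  have ht := N.φ.open_target.mem_nhds h0
  exact ⟨fun k => (N.X_smooth k).contDiffAt ht,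
    mem_of_superset ht fun y hy => N.hor_symm y hy,
    mem_of_superset ht fun y hy => N.hor_radial y hy,
    mem_of_superset ht fun y hy => N.vert_radial y hy,
    N.reduced⟩

/-- The covector with given coordinates in the normal form chart. -/
noncomputable def ofCoord (N : AGNormalForm S q₀) (w : Coord n × (Coord n →L[ℝ] ℝ)) :
    CotBundle n M :=
  ⟨N.φ.symm w.1, w.2.comp (chartDeriv N.φ (N.φ.symm w.1))⟩

theorem chartCov_ofCoord (N : AGNormalForm S q₀) {w : Coord n × (Coord n →L[ℝ] ℝ)}
    (hw : w.1 ∈ N.φ.target) : chartCov N.φ (N.ofCoord w) = w := by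
  refine Prod.ext (N.φ.right_inv hw) (ContinuousLinearMap.ext fun v => ?_)
  change w.2 (chartDeriv N.φ (N.φ.symm w.1) ((chartDeriv N.φ (N.φ.symm w.1)).inverse v)) = w.2 v
  rw [chartDeriv_inverse_apply N.φ_mem (N.φ.map_target hw)]

theorem frameIn_apply (N : AGNormalForm S q₀) {ψ : OpenPartialHomeomorph M (Coord n)} {q : M}
    (hq : q ∈ ψ.source) (k : HIdx n) :
    N.frameIn ψ k (ψ q) = chartDeriv ψ q (N.X k q : TangentSpace 𝓘(ℝ, Coord n) q) := by
  rw [frameIn, fieldInChart, ψ.left_inv hq]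

theorem hCoord_eq (N : AGNormalForm S q₀) {c : CotBundle n M} (hc : c.1 ∈ N.φ.source) :
    N.hCoord c = momenta (N.frameIn N.φ) (chartCov N.φ c) := by
  ext k
  simp only [hCoord, momenta, chartCov]
  rw [N.frameIn_apply hc, covInChart_chartDeriv N.φ_mem hc]

theorem h0Coord_eq (N : AGNormalForm S q₀) (c : CotBundle n M) :
    N.h0Coord c = (chartCov N.φ c).2 (dz n) := rfl

/-- The initial conditions in the normal form chart. -/
theorem isInitial_iff (N : AGNormalForm S q₀) {h : Hor n} {η : ℝ} (hη : η ≠ 0)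
    {c : CotBundle n M} : N.IsInitial h η c ↔ c.1 ∈ N.φ.source ∧
      chartCov N.φ c = ((startPoint η h).1, η⁻¹ • (startPoint η h).2) := by
  have hmom : ∀ ξ : Coord n →L[ℝ] ℝ, ∀ k,
      momenta (N.frameIn N.φ) (0, ξ) k = ξ (dx k) := fun ξ k => by
    rw [momenta, N.isNormalFrame.apply_zero]
  have hst : ∀ k, (startPoint η h).2 (dx k) = η * h k := fun k => by
    simp [startPoint, horCov_apply, dx, Pi.single_apply]
  have hst0 : (startPoint η h).2 (dz n) = 1 := by
    simp [startPoint, horCov_apply, dz]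
  constructor
  · rintro ⟨hq, hh, h0⟩
    have hs : c.1 ∈ N.φ.source := hq ▸ N.mem_source
    refine ⟨hs, ?_⟩
    have h1 : (chartCov N.φ c).1 = 0 := by rw [chartCov, hq, N.φ_center]
    refine Prod.ext h1 (ContinuousLinearMap.ext fun v => ?_)
    have hc : chartCov N.φ c = (0, (chartCov N.φ c).2) := Prod.ext h1 rfl
    rw [N.hCoord_eq hs, hc] at hh
    have h2 : ∀ k, (chartCov N.φ c).2 (dx k) = h k := fun k => by rw [← hmom, hh]
    rw [N.h0Coord_eq] at h0
    rw [coord_eq_sum v]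
    simp only [map_add, map_sum, map_smul, smul_apply, smul_eq_mul, hst, hst0, h2, h0,
      inv_mul_cancel_left₀ hη, mul_one]
  · rintro ⟨hs, hc⟩
    have hq : c.1 = q₀ := by
      refine N.φ.injOn hs N.mem_source ?_
      rw [N.φ_center]
      exact congrArg Prod.fst hc
    refine ⟨hq, ?_, ?_⟩
    · rw [N.hCoord_eq hs, hc]
      ext k
      simp only [startPoint]
      rw [hmom]
      change η⁻¹ * (startPoint η h).2 (dx k) = _
      rw [hst]
      field_simp
    · rw [N.h0Coord_eq, hc]
      change η⁻¹ * (startPoint η h).2 (dz n) = _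
      rw [hst0, mul_one]

variable [IsManifold 𝓘(ℝ, Coord n) ∞ M]

/-- Hamilton's equations in the normal form chart imply Hamilton's equations in all charts. -/
theorem hasDerivWithinAt_chartCov (N : AGNormalForm S q₀)
    {ψ : OpenPartialHomeomorph M (Coord n)}
    (hψ : ψ ∈ IsManifold.maximalAtlas 𝓘(ℝ, Coord n) ∞ M) {c : ℝ → CotBundle n M} {s : Set ℝ}
    {t : ℝ} (ht : t ∈ s) (hc : ContinuousWithinAt (fun r => (c r).1) s t)
    (hq : (c t).1 ∈ N.φ.source) (hq' : (c t).1 ∈ ψ.source)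
    (h : HasDerivWithinAt (fun r => chartCov N.φ (c r))
      (hamField (N.frameIn N.φ) (chartCov N.φ (c t))) s t) :
    HasDerivWithinAt (fun r => chartCov ψ (c r))
      (hamField (N.frameIn ψ) (chartCov ψ (c t))) s t := by
  have hev : ∀ᶠ r in 𝓝[s] t, (c r).1 ∈ N.φ.source ∧ (c r).1 ∈ ψ.source :=
    (hc.eventually_mem (N.φ.open_source.mem_nhds hq)).and
      (hc.eventually_mem (ψ.open_source.mem_nhds hq'))
  have hb : HasDerivWithinAt (fun r => N.φ (c r).1)
      (hamField (N.frameIn N.φ) (chartCov N.φ (c t))).1 s t :=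
    hasDerivWithinAt_prod_fst h
  have hcov : HasDerivWithinAt (fun r => (chartCov N.φ (c r)).2)
      (hamField (N.frameIn N.φ) (chartCov N.φ (c t))).2 s t :=
    hasDerivWithinAt_prod_snd h
  have hback : N.φ (ψ.symm (ψ (c t).1)) = N.φ (c t).1 := by rw [ψ.left_inv hq']
  have hmom : ∀ k, covInChart ψ (c t) (N.frameIn ψ k (ψ (c t).1)) =
      covInChart N.φ (c t) (N.frameIn N.φ k (N.φ (c t).1)) := by
    intro k
    rw [N.frameIn_apply hq', N.frameIn_apply hq, covInChart_chartDeriv hψ hq',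
      covInChart_chartDeriv N.φ_mem hq]
  have hbase : HasDerivWithinAt (fun r => ψ (c r).1)
      (hamField (N.frameIn ψ) (chartCov ψ (c t))).1 s t := by
    have hg := ((contDiffAt_transition N.φ_mem hψ hq hq').differentiableAt
      (by simp)).hasFDerivAt
    refine HasDerivWithinAt.congr_deriv
      ((hg.comp_hasDerivWithinAt t hb).congr_of_eventuallyEq ?_ ?_) ?_
    · filter_upwards [hev] with r hr
      simp [N.φ.left_inv hr.1]
    · simp [N.φ.left_inv hq]
    · simp only [hamField, chartCov, map_sum, map_smul, hmom]
      refine Finset.sum_congr rfl fun k _ => ?_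
      rw [N.frameIn_apply hq', N.frameIn_apply hq,
        chartDeriv_eq_fderiv_transition N.φ_mem hψ hq hq']
  refine hbase.prodMk ?_
  refine hasDerivWithinAt_cov_of_change (X := N.frameIn N.φ) (κ := N.φ ∘ ψ.symm)
    (v := fun r => chartCov N.φ (c r)) (w := fun r => chartCov ψ (c r)) ht
    ((contDiffAt_transition hψ N.φ_mem hq' hq).of_le two_le_infty) (fun k => ?_)
    (fun k => (N.contDiffAt_frameIn hψ hq hq' k).differentiableAt (by simp)) (fun k => ?_)
    hback.symm hcov hbase ?_
  · have : (N.φ ∘ ψ.symm) (chartCov ψ (c t)).1 = N.φ (c t).1 := hback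
    rw [this]
    exact (N.contDiffAt_frameIn N.φ_mem hq hq k).differentiableAt (by simp)
  · filter_upwards [eventually_mem_target_and_mem_source hq hq'] with y hy
    exact fieldInChart_transition N.φ_mem hψ _ hy.1 hy.2
  · filter_upwards [hev] with r hr
    exact covInChart_transition N.φ_mem hψ hr.1 hr.2

/-- Solutions of Hamilton's equations in the normal form chart are normal extremals. -/
theorem isNormalExtremal_ofCoord (N : AGNormalForm S q₀)
    {w : ℝ → Coord n × (Coord n →L[ℝ] ℝ)} {s : Set ℝ} (hw : ∀ t ∈ s, (w t).1 ∈ N.φ.target)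
    (hd : ∀ t ∈ s, HasDerivWithinAt w (hamField (N.frameIn N.φ) (w t)) s t) :
    S.IsNormalExtremal (fun t => N.ofCoord (w t)) s := by
  have hcont : ContinuousOn (fun t => (N.ofCoord (w t)).1) s := fun t ht =>
    ContinuousAt.comp_continuousWithinAt (f := fun t => (w t).1)
      (N.φ.continuousAt_symm (hw t ht)) (hd t ht).continuousWithinAt.fst
  refine ⟨hcont, fun t ht ψ hψ hq => ?_⟩
  have hqφ : (N.ofCoord (w t)).1 ∈ N.φ.source := N.φ.map_target (hw t ht)
  refine (N.hamilton_iff (c := fun t => N.ofCoord (w t)) hψ hqφ hq).2 ?_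
  refine N.hasDerivWithinAt_chartCov (c := fun t => N.ofCoord (w t)) hψ ht (hcont t ht) hqφ hq ?_
  rw [N.chartCov_ofCoord (hw t ht)]
  exact (hd t ht).congr (fun r hr => N.chartCov_ofCoord (hw r hr)) (N.chartCov_ofCoord (hw t ht))

/-- Uniqueness of normal extremals which start as a given solution in the normal form chart. -/
theorem chartCov_eq_of_isNormalExtremal [T2Space M] (N : AGNormalForm S q₀)
    {w : ℝ → Coord n × (Coord n →L[ℝ] ℝ)} {a : ℝ} (hw : ∀ t ∈ Icc 0 a, (w t).1 ∈ N.φ.target)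
    (hd : ∀ t ∈ Icc 0 a, HasDerivWithinAt w (hamField (N.frameIn N.φ) (w t)) (Icc 0 a) t)
    {c : ℝ → CotBundle n M} (hc : S.IsNormalExtremal c (Icc 0 a))
    (hc0 : (c 0).1 ∈ N.φ.source) (hcw : chartCov N.φ (c 0) = w 0) :
    ∀ t ∈ Icc 0 a, (c t).1 ∈ N.φ.source ∧ chartCov N.φ (c t) = w t := by
  have hder : ∀ t ∈ Icc 0 a, (c t).1 ∈ N.φ.source →
      HasDerivWithinAt (fun u => chartCov N.φ (c u))
        (hamField (N.frameIn N.φ) (chartCov N.φ (c t))) (Icc 0 a) t := fun t ht hq =>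
    (N.hamilton_iff N.φ_mem hq hq).1 (hc.2 t ht N.φ N.φ_mem hq)
  set A : Set ℝ := {t | (c t).1 ∈ N.φ.source ∧ chartCov N.φ (c t) = w t} with hA
  -- An extremal cannot leave the chart at a limit of agreement times: as `M` is Hausdorff, its
  -- position there is the image under `N.φ.symm` of the base point of `w`.
  have hclosed : IsClosed (A ∩ Icc 0 a) := by
    refine isClosed_of_closure_subset fun t ht => ?_
    have htI : t ∈ Icc 0 a := by
      have := closure_mono (inter_subset_right (s := A) (t := Icc 0 a)) ht
      rwa [isClosed_Icc.closure_eq] at this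
    have hne : (𝓝[A ∩ Icc 0 a] t).NeBot := mem_closure_iff_nhdsWithin_neBot.1 ht
    have hle : 𝓝[A ∩ Icc 0 a] t ≤ 𝓝[Icc 0 a] t := nhdsWithin_mono _ inter_subset_right
    have hwt : Tendsto w (𝓝[A ∩ Icc 0 a] t) (𝓝 (w t)) :=
      (hd t htI).continuousWithinAt.mono_left hle
    have h1 : Tendsto (fun r => (c r).1) (𝓝[A ∩ Icc 0 a] t) (𝓝 (c t).1) :=
      (hc.1 t htI).mono_left hle
    have h2 : Tendsto (fun r => (c r).1) (𝓝[A ∩ Icc 0 a] t) (𝓝 (N.φ.symm (w t).1)) := by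
      refine ((N.φ.continuousAt_symm (hw t htI)).tendsto.comp
        ((continuous_fst.tendsto _).comp hwt)).congr' ?_
      filter_upwards [self_mem_nhdsWithin] with r hr
      simp [← hr.1.2, chartCov, N.φ.left_inv hr.1.1]
    have hq : (c t).1 = N.φ.symm (w t).1 := tendsto_nhds_unique h1 h2
    have hqs : (c t).1 ∈ N.φ.source := hq ▸ N.φ.map_target (hw t htI)
    have h3 : Tendsto (fun r => chartCov N.φ (c r)) (𝓝[A ∩ Icc 0 a] t)
        (𝓝 (chartCov N.φ (c t))) := (hder t htI hqs).continuousWithinAt.mono_left hle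
    have h4 : Tendsto (fun r => chartCov N.φ (c r)) (𝓝[A ∩ Icc 0 a] t) (𝓝 (w t)) := by
      refine hwt.congr' ?_
      filter_upwards [self_mem_nhdsWithin] with r hr using hr.1.2.symm
    exact ⟨⟨hqs, tendsto_nhds_unique h3 h4⟩, htI⟩
  refine hclosed.Icc_subset_of_forall_exists_gt ⟨hc0, hcw⟩ ?_
  rintro t ⟨⟨hqt, hct⟩, htI⟩ y hy
  have htI' := Ico_subset_Icc_self htI
  -- Agreement extends to the right of `t` by local uniqueness, the field being Lipschitz on a
  -- neighborhood `O` of `w t` in which both curves stay for a short time.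
  have hCD : ContDiffAt ℝ 1 (hamField (N.frameIn N.φ)) (w t) :=
    contDiffAt_hamField fun k => (N.X_smooth k).contDiffAt (N.φ.open_target.mem_nhds (hw t htI'))
  obtain ⟨K, O, hO, hLip⟩ := hCD.exists_lipschitzOnWith
  have hev : ∀ᶠ r in 𝓝[Icc 0 a] t, (c r).1 ∈ N.φ.source ∧ w r ∈ O ∧ chartCov N.φ (c r) ∈ O :=
    ((hc.1 t htI').eventually_mem (N.φ.open_source.mem_nhds hqt)).and
      (((hd t htI').continuousWithinAt.eventually_mem hO).and
        ((hder t htI' hqt).continuousWithinAt.eventually_mem (by simpa only [hct] using hO)))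
  have hge : 𝓝[≥] t ≤ 𝓝[Icc 0 a] t := nhdsWithin_le_of_mem (Icc_mem_nhdsGE_of_mem htI)
  obtain ⟨m, hm, hsub⟩ := (mem_nhdsGE_iff_exists_Icc_subset).1
    (inter_mem (hge hev) (Icc_mem_nhdsGE_of_mem htI))
  have hsub' : ∀ r ∈ Ico t m, Icc 0 a ∈ 𝓝[≥] r := by
    intro r hr
    have hrI := (hsub (Ico_subset_Icc_self hr)).2
    have hma : m ≤ a := (hsub (right_mem_Icc.2 (le_of_lt hm))).2.2
    exact Icc_mem_nhdsGE_of_mem ⟨hrI.1, hr.2.trans_le hma⟩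
  have heq : EqOn (fun r => chartCov N.φ (c r)) w (Icc t m) := by
    refine ODE_solution_unique_of_mem_Icc_right (v := fun _ => hamField (N.frameIn N.φ))
      (s := fun _ => O) (K := K) (fun _ _ => hLip) ?_ ?_ ?_ ?_ ?_ ?_ hct
    · exact fun r hr => (hder r (hsub hr).2 (hsub hr).1.1).continuousWithinAt.mono
        fun x hx => (hsub hx).2
    · exact fun r hr => (hder r (hsub (Ico_subset_Icc_self hr)).2
        (hsub (Ico_subset_Icc_self hr)).1.1).mono_of_mem_nhdsWithin (hsub' r hr)
    · exact fun r hr => (hsub (Ico_subset_Icc_self hr)).1.2.2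
    · exact fun r hr => (hd r (hsub hr).2).continuousWithinAt.mono fun x hx => (hsub hx).2
    · exact fun r hr => (hd r (hsub (Ico_subset_Icc_self hr)).2).mono_of_mem_nhdsWithin (hsub' r hr)
    · exact fun r hr => (hsub (Ico_subset_Icc_self hr)).1.2.1
  have hmin : min m y ∈ Icc t m := ⟨le_min (le_of_lt hm) (le_of_lt hy), min_le_left _ _⟩
  exact ⟨min m y, ⟨(hsub hmin).1.1, heq hmin⟩, lt_min hm hy, min_le_right _ _⟩

end AGNormalForm

end Extremals

/-! ### Undoing the rescaling and collecting the estimates -/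

section Main

variable {n : ℕ} {M : Type*} [TopologicalSpace M] [T2Space M] [ChartedSpace (Coord n) M]
  [IsManifold 𝓘(ℝ, Coord n) ∞ M] {S : ContactSubRiemannian n M} {q₀ : M}

theorem abs_inv_sub_one_le {a : ℝ} (ha : 1 / 2 < a) : |a⁻¹ - 1| ≤ 2 * |a - 1| := by
  have h0 : 0 < a := by linarith
  have e : a⁻¹ - 1 = -(a⁻¹ * (a - 1)) := by
    field_simp
    ring
  have h2 : a⁻¹ ≤ 2 := by
    rw [inv_le_comm₀ h0 two_pos]
    linarith
  rw [e, abs_neg, abs_mul, abs_of_pos (inv_pos.2 h0)]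
  exact mul_le_mul_of_nonneg_right h2 (abs_nonneg _)

theorem AGNormalForm.normalExtremal_expansion (N : AGNormalForm S q₀) {T R : ℝ} (hT : 0 < T) :
    ∃ C : ℝ, ∃ η₀ : ℝ, 0 < η₀ ∧ ∀ η : ℝ, 0 < η → η < η₀ → ∀ h ∈ ballB n R,
      (∃ c : ℝ → CotBundle n M,
        S.IsNormalExtremal c (Set.Icc 0 (η * T)) ∧ N.IsInitial h η (c 0)) ∧
      ∀ τ ∈ Set.Icc (0 : ℝ) T, ∀ c : ℝ → CotBundle n M,
        S.IsNormalExtremal c (Set.Icc 0 (η * τ)) → N.IsInitial h η (c 0) →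
          (c (η * τ)).1 ∈ N.φ.source ∧
          ‖N.xCoord (c (η * τ)) - (η • xHat N.b τ h + η ^ 2 • N.x2 τ h)‖ ≤ C * η ^ 3 ∧
          |N.zCoord (c (η * τ)) - η ^ 2 * zHat N.b τ h| ≤ C * η ^ 3 ∧
          ‖N.hCoord (c (η * τ)) - (hHat N.b τ h + η • N.h1 τ h)‖ ≤ C * η ^ 2 ∧
          ∃ w : ℝ, 0 < w ∧ N.h0Coord (c (η * τ)) = (η * w)⁻¹ ∧ |w - 1| ≤ C * η ^ 2 := by
  have hX := N.isNormalFrame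
  have hb : ∀ i, N.b i ≠ 0 := fun i => (N.b_pos i).ne'
  obtain ⟨u, hu⟩ := exists_solutionFamily hX (B := ballB n R)
    (fun h hh => norm_horCov_le_of_mem_ballB hh) hT.le
  obtain ⟨Cx, hCx⟩ := isBigO_unif.1 (hu.isBigO_hor_expansion hX hb)
  obtain ⟨Cz, hCz⟩ := isBigO_unif.1 (hu.isBigO_vert_expansion hX hb)
  obtain ⟨Ch, hCh⟩ := isBigO_unif.1 (hu.isBigO_momenta_expansion hX hb)
  obtain ⟨Cw, hCw⟩ := isBigO_unif.1 (hu.isBigO_reeb hX)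
  have hreeb : ∀ᶠ p in unif (ballB n R) T, 1 / 2 < (u p).2 (dz n) := by
    have h1 : Tendsto (fun p => (u p).2 (dz n) - 1) (unif (ballB n R) T) (𝓝 0) :=
      (hu.isBigO_reeb hX).trans_tendsto
        (by simpa using (tendsto_unif_fst (B := ballB n R) (T := T)).pow 2)
    filter_upwards [h1.eventually (lt_mem_nhds (show -(1 / 2 : ℝ) < 0 by norm_num))] with p hp
    linarith
  have htgt : ∀ᶠ p in unif (ballB n R) T, (u p).1 ∈ N.φ.target :=
    hu.tendsto_base.eventually (N.φ.open_target.mem_nhds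
      (N.φ_center ▸ N.φ.map_source N.mem_source))
  obtain ⟨η₀, hη₀, hsub⟩ := mem_nhdsGT_iff_exists_Ioo_subset.1
    (hu.init.and (hu.deriv.and (hCx.and (hCz.and (hCh.and (hCw.and
      ((eventually_unif.1 hreeb).and (eventually_unif.1 htgt))))))))
  -- The factor `2` is the price of inverting `⟨ξ, ∂_z⟩ > 1 / 2` to obtain `w`.
  refine ⟨|Cx| + |Cz| + |Ch| + 2 * |Cw|, η₀, hη₀, fun η hη hηη₀ h hh => ?_⟩
  obtain ⟨hinit, hderiv, hx, hz, hmom, hw, hre, htg⟩ := hsub ⟨hη, hηη₀⟩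
  have hdivmem : ∀ t ∈ Icc 0 (η * T), t / η ∈ Icc 0 T := fun t ht =>
    ⟨div_nonneg ht.1 hη.le, by rw [div_le_iff₀ hη, mul_comm]; exact ht.2⟩
  set w : ℝ → Coord n × (Coord n →L[ℝ] ℝ) := fun t =>
    ((u (η, h, t / η)).1, η⁻¹ • (u (η, h, t / η)).2) with hwdef
  have hwt : ∀ t ∈ Icc 0 (η * T), (w t).1 ∈ N.φ.target := fun t ht =>
    htg h hh _ (hdivmem t ht)
  have hwd : ∀ t ∈ Icc 0 (η * T),
      HasDerivWithinAt w (hamField (N.frameIn N.φ) (w t)) (Icc 0 (η * T)) t := fun t ht =>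
    hasDerivWithinAt_rescale hη (hderiv h hh _ (hdivmem t ht))
  have hw0 : w 0 = ((startPoint η h).1, η⁻¹ • (startPoint η h).2) := by
    simp [hwdef, hinit h hh]
  have h0 : (0 : ℝ) ∈ Icc 0 (η * T) := left_mem_Icc.2 (by positivity)
  refine ⟨⟨fun t => N.ofCoord (w t), N.isNormalExtremal_ofCoord hwt hwd, ?_⟩, ?_⟩
  · rw [N.isInitial_iff hη.ne', N.chartCov_ofCoord (hwt 0 h0)]
    exact ⟨N.φ.map_target (hwt 0 h0), hw0⟩
  intro τ hτ c hc hc0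
  obtain ⟨hcs, hc0⟩ := (N.isInitial_iff hη.ne').1 hc0
  have hle : Icc 0 (η * τ) ⊆ Icc 0 (η * T) :=
    Icc_subset_Icc_right (mul_le_mul_of_nonneg_left hτ.2 hη.le)
  obtain ⟨hs, hcw⟩ := N.chartCov_eq_of_isNormalExtremal (fun t ht => hwt t (hle ht))
    (fun t ht => (hwd t (hle ht)).mono hle) hc hcs (hc0.trans hw0.symm) (η * τ)
    (right_mem_Icc.2 (mul_nonneg hη.le hτ.1))
  have hwτ : w (η * τ) = ((u (η, h, τ)).1, η⁻¹ • (u (η, h, τ)).2) := by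
    simp [hwdef, mul_div_cancel_left₀ τ hη.ne']
  rw [hwτ] at hcw
  have hbase : N.φ (c (η * τ)).1 = (u (η, h, τ)).1 := congrArg Prod.fst hcw
  have hpos : ∀ k, 0 < η ^ k := fun k => pow_pos hη k
  refine ⟨hs, ?_, ?_, ?_, ((u (η, h, τ)).2 (dz n))⁻¹, ?_, ?_, ?_⟩
  · rw [AGNormalForm.xCoord, hbase]
    refine (hx h hh τ hτ).trans (mul_le_mul_of_nonneg_right ?_ (hpos 3).le)
    linarith [le_abs_self Cx, abs_nonneg Cz, abs_nonneg Ch, abs_nonneg Cw]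
  · rw [AGNormalForm.zCoord, hbase]
    refine (hz h hh τ hτ).trans (mul_le_mul_of_nonneg_right ?_ (hpos 3).le)
    linarith [le_abs_self Cz, abs_nonneg Cx, abs_nonneg Ch, abs_nonneg Cw]
  -- The coordinates `h` are the rescaled momenta divided by `η`, which lowers the error from `η ^
  -- 3` to `η ^ 2`.
  · have e : N.hCoord (c (η * τ)) - (hHat N.b τ h + η • N.h1 τ h) =
        η⁻¹ • (momenta (N.frameIn N.φ) (u (η, h, τ)) -
          (η • hHat N.b τ h + η ^ 2 • frameH1 (N.frameIn N.φ) N.b τ h)) := by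
      rw [N.hCoord_eq hs, hcw, smul_sub, smul_add, smul_smul, smul_smul,
        inv_mul_cancel₀ hη.ne', one_smul, sq, inv_mul_cancel_left₀ hη.ne']
      rfl
    rw [e, norm_smul, Real.norm_of_nonneg (inv_nonneg.2 hη.le), inv_mul_le_iff₀ hη]
    refine (hmom h hh τ hτ).trans ?_
    have : Ch * η ^ 3 = η * (Ch * η ^ 2) := by ring
    rw [this]
    refine mul_le_mul_of_nonneg_left (mul_le_mul_of_nonneg_right ?_ (hpos 2).le) hη.le
    linarith [le_abs_self Ch, abs_nonneg Cx, abs_nonneg Cz, abs_nonneg Cw]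
  · exact inv_pos.2 (by linarith [hre h hh τ hτ])
  · rw [N.h0Coord_eq, hcw, mul_inv, inv_inv]
    rfl
  · have h1 := hw h hh τ hτ
    rw [Real.norm_eq_abs] at h1
    have h2 : Cw * η ^ 2 ≤ |Cw| * η ^ 2 := mul_le_mul_of_nonneg_right (le_abs_self _) (hpos 2).le
    have h3 : 2 * (|Cw| * η ^ 2) ≤ (|Cx| + |Cz| + |Ch| + 2 * |Cw|) * η ^ 2 := by
      rw [← mul_assoc]
      refine mul_le_mul_of_nonneg_right ?_ (hpos 2).le
      linarith [abs_nonneg Cx, abs_nonneg Cz, abs_nonneg Ch]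
    linarith [abs_inv_sub_one_le (hre h hh τ hτ)]

end Main

end SubRiem

theorem propositionP {n : ℕ} (hn : 1 ≤ n) {M : Type*} [TopologicalSpace M] [T2Space M]
    [ChartedSpace (SubRiem.Coord n) M] [IsManifold 𝓘(ℝ, SubRiem.Coord n) ∞ M]
    (S : SubRiem.ContactSubRiemannian n M) (q₀ : M) (N : SubRiem.AGNormalForm S q₀)
    (T R : ℝ) (hT : 0 < T) (hR : 0 < R) :
    ∃ C : ℝ, ∃ η₀ : ℝ, 0 < η₀ ∧ ∀ η : ℝ, 0 < η → η < η₀ → ∀ h ∈ SubRiem.ballB n R,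
      (∃ c : ℝ → SubRiem.CotBundle n M,
        S.IsNormalExtremal c (Set.Icc 0 (η * T)) ∧ N.IsInitial h η (c 0)) ∧
      ∀ τ ∈ Set.Icc (0 : ℝ) T, ∀ c : ℝ → SubRiem.CotBundle n M,
        S.IsNormalExtremal c (Set.Icc 0 (η * τ)) → N.IsInitial h η (c 0) →
          (c (η * τ)).1 ∈ N.φ.source ∧
          ‖N.xCoord (c (η * τ)) - (η • SubRiem.xHat N.b τ h + η ^ 2 • N.x2 τ h)‖ ≤ C * η ^ 3 ∧
          |N.zCoord (c (η * τ)) - η ^ 2 * SubRiem.zHat N.b τ h| ≤ C * η ^ 3 ∧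
          ‖N.hCoord (c (η * τ)) - (SubRiem.hHat N.b τ h + η • N.h1 τ h)‖ ≤ C * η ^ 2 ∧
          ∃ w : ℝ, 0 < w ∧ N.h0Coord (c (η * τ)) = (η * w)⁻¹ ∧ |w - 1| ≤ C * η ^ 2 :=
  N.normalExtremal_expansion hT
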